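/- Let $\mathbb{C}^*=\mathbb{C}\setminus\{0\}$, let $H(\mathbb{C}^*)$ be the space of holomorphic functions on $\mathbb{C}^*$ with the compact-open topology, and let $\omega:\mathbb{C}^*\to\mathbb{C}$ and $\psi:\mathbb{C}^*\to\mathbb{C}^*$ be holomorphic. Let $T=C_{\omega,\psi}:H(\mathbb{C}^*)\to H(\mathbb{C}^*)$ be the weighted composition operator $T f(z)=\omega(z)\,f(\psi(z))$. Then the following are equivalent: 1. $T$ is supercyclic: there is $f\in H(\mathbb{C}^*)$ such that $\{\lambda T^n f:\lambda\in\mathbb{C},\ n\ge 0\}$ is dense in $H(\mathbb{C}^*)$. 2. $T$ satisfies the Frequent Hypercyclicity Criterion: there are a dense subset $X_0\subseteq H(\mathbb{C}^*)$ and a map $S:X_0\to X_0$ such that for each $f\in X_0$ the series $\sum_{n\ge1}T^nf$ and $\sum_{n\ge1}S^nf$ converge unconditionally and $TSf=f$. 3. There exist an integer $n\ge 1$, a function $W\in H(\mathbb{C}^*)$ and $a\in\mathbb{C}$ with $0<|a|<1$ such that either $\omega(z)=z^ne^{W(z)}$ and $\psi(z)=az$ for all $z\in\mathbb{C}^*$,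 or $\omega(z)=z^{-n}e^{W(z)}$ and $\psi(z)=\frac1a z$ for all $z\in\mathbb{C}^*$. Moreover, if these conditions hold, then $T$ is frequently hypercyclic (there is $f$ with $\liminf_{N\to\infty}\frac{1}{N+1}\operatorname{card}\{0\le n\le N: T^nf\in U\}>0$ for every non-empty open $U\subseteq H(\mathbb{C}^*)$), mixing (for all non-empty open $U,V\subseteq H(\mathbb{C}^*)$ one has $T^k(U)\cap V\neq\emptyset$ for all large $k$) and chaotic (for all non-empty open $U,V\subseteq H(\mathbb{C}^*)$ one has $T^k(U)\cap V\ne\emptyset$ for some $k\ge 0$, and the set of $f$ with $T^rf=f$ for some $r\ge1$ is dense). In particular, the problem of Goliński and Przestacki has an affirmative answer: if $T$ is hypercyclic (that is, $\{T^nf:n\ge0\}$ is dense for some $f\in H(\mathbb{C}^*)$), then $T$ is frequently hypercyclic; and $T$ is frequently hypercyclic when $\omega(z)=z\,e^{1/z}$ and $\psi(z)=z/2$. -/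

import Mathlib

open Filter Topology TopologicalSpace

/-! ### Dynamics of operators on topological vector spaces -/

section Dynamics

variable {X : Type*} [AddCommMonoid X] [Module ℂ X] [TopologicalSpace X]

/-- Some vector `f` has a dense orbit `{T^n f : n = 0, 1, …}`. -/
def IsHypercyclic (T : X →L[ℂ] X) : Prop :=
  ∃ f : X, Dense {g : X | ∃ n : ℕ, g = T^[n] f}

/-- Some vector `f` has a dense projective orbit `{c T^n f : c ∈ ℂ, n = 0, 1, …}`. -/
def IsSupercyclic (T : X →L[ℂ] X) : Prop :=
  ∃ f : X, Dense {g : X | ∃ (c : ℂ) (n : ℕ), g = c • T^[n] f}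

/-- Topological transitivity: some `T^n(U)` meets `V`, for all non-empty open `U`, `V`. -/
def IsTopTransitive (T : X →L[ℂ] X) : Prop :=
  ∀ U V : Set X, IsOpen U → U.Nonempty → IsOpen V → V.Nonempty →
    ∃ n : ℕ, ((T^[n] '' U) ∩ V).Nonempty

/-- Topological mixing: `T^k(U)` meets `V` for all large `k`, for all non-empty open `U`, `V`. -/
def IsTopMixing (T : X →L[ℂ] X) : Prop :=
  ∀ U V : Set X, IsOpen U → U.Nonempty → IsOpen V → V.Nonempty →
    ∃ n : ℕ, ∀ k : ℕ, n ≤ k → ((T^[k] '' U) ∩ V).Nonempty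

/-- Topologically transitive, with a dense set of periodic points (of periods `r ≥ 1`). -/
def IsChaotic (T : X →L[ℂ] X) : Prop :=
  IsTopTransitive T ∧ Dense (Function.periodicPts T)

/-- Some vector `f` visits every non-empty open set `U` along a set of times of positive lower
density: `liminf_N card {0 ≤ n ≤ N : T^n f ∈ U} / (N + 1) > 0`. The quotients lie in `[0, 1]`, so
the real-valued `liminf` is the genuine one. -/
def IsFrequentlyHypercyclic (T : X →L[ℂ] X) : Prop :=
  ∃ f : X, ∀ U : Set X, IsOpen U → U.Nonempty →
    0 < liminf (fun N : ℕ => (({n : ℕ | n ≤ N ∧ T^[n] f ∈ U}.ncard : ℝ) / ((N : ℝ) + 1))) atTop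

/-- The Frequent Hypercyclicity Criterion: there are a dense set `X₀` and a map `S : X₀ → X₀` such
that for each `f ∈ X₀` the series `∑_{n ≥ 1} T^n f` and `∑_{n ≥ 1} S^n f` converge unconditionally
in `X` (`Summable`) and `T S f = f`. -/
def SatisfiesFHC (T : X →L[ℂ] X) : Prop :=
  ∃ X₀ : Set X, Dense X₀ ∧ ∃ S : X₀ → X₀, ∀ f : X₀,
    Summable (fun n : ℕ => T^[n + 1] (f : X)) ∧
    Summable (fun n : ℕ => ((S^[n + 1] f : X₀) : X)) ∧
    T (S f : X) = f

end Dynamics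

/-! ### Spaces of holomorphic functions and weighted composition operators -/

/-- `f : Ω → ℂ` is holomorphic on the open set `Ω`: it is the restriction to `Ω` of a function
that is complex differentiable at every point of `Ω`. -/
def IsHolo (Ω : Opens ℂ) (f : Ω → ℂ) : Prop :=
  ∃ F : ℂ → ℂ, DifferentiableOn ℂ F Ω ∧ ∀ z : Ω, f z = F z

theorem IsHolo.continuous {Ω : Opens ℂ} {f : Ω → ℂ} (hf : IsHolo Ω f) : Continuous f := by
  obtain ⟨F, hF, h⟩ := hf
  rw [show f = (Ω : Set ℂ).domRestrict F from funext h]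
  exact continuousOn_iff_continuous_domRestrict.1 hF.continuousOn

theorem IsHolo.mul {Ω : Opens ℂ} {f g : Ω → ℂ} (hf : IsHolo Ω f) (hg : IsHolo Ω g) :
    IsHolo Ω (fun z => f z * g z) := by
  obtain ⟨F, hF, h⟩ := hf
  obtain ⟨G, hG, k⟩ := hg
  exact ⟨fun z => F z * G z, hF.mul hG, fun z => by simp only [h, k]⟩

theorem IsHolo.comp {Ω : Opens ℂ} {f : Ω → ℂ} {ψ : Ω → Ω} (hf : IsHolo Ω f)
    (hψ : IsHolo Ω (fun z => (ψ z : ℂ))) : IsHolo Ω (fun z => f (ψ z)) := by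
  obtain ⟨F, hF, h⟩ := hf
  obtain ⟨G, hG, k⟩ := hψ
  refine ⟨fun z => F (G z), hF.comp hG ?_, fun z => by simp only [h, ← k]⟩
  intro z hz
  have hk : G z = ψ ⟨z, hz⟩ := (k ⟨z, hz⟩).symm
  exact hk ▸ (ψ ⟨z, hz⟩).2

/-- The space `H(Ω)` of holomorphic functions on `Ω`, as a subspace of `C(Ω, ℂ)`; its topology is
the compact-open topology inherited from there. -/
def HoloSpace (Ω : Opens ℂ) : Submodule ℂ C(Ω, ℂ) where
  carrier := {f | IsHolo Ω f}
  zero_mem' := ⟨fun _ => 0, differentiableOn_const 0, fun _ => rfl⟩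
  add_mem' := by
    rintro f g ⟨F, hF, h⟩ ⟨G, hG, k⟩
    exact ⟨fun z => F z + G z, hF.add hG, fun z => by rw [ContinuousMap.add_apply, h, k]⟩
  smul_mem' := by
    rintro c f ⟨F, hF, h⟩
    exact ⟨fun z => c * F z, hF.const_mul c,
      fun z => by rw [ContinuousMap.smul_apply, h, smul_eq_mul]⟩

/-- The weighted composition operator `C_{ω,ψ} : H(Ω) → H(Ω)`, `f ↦ ω · (f ∘ ψ)`, with holomorphic
multiplier `ω : Ω → ℂ` and holomorphic symbol `ψ : Ω → Ω`. -/
noncomputable def weightedComp {Ω : Opens ℂ} (ω : Ω → ℂ) (hω : IsHolo Ω ω) (ψ : Ω → Ω)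
    (hψ : IsHolo Ω (fun z => (ψ z : ℂ))) : HoloSpace Ω →L[ℂ] HoloSpace Ω where
  toFun f := ⟨⟨fun z => ω z * f.1 (ψ z), (hω.mul (IsHolo.comp f.2 hψ)).continuous⟩,
    hω.mul (IsHolo.comp f.2 hψ)⟩
  map_add' f g := by
    ext z
    exact mul_add _ _ _
  map_smul' c f := by
    ext z
    exact mul_left_comm _ _ _
  cont := by
    refine Continuous.subtype_mk ?_ _
    have : LocallyCompactSpace Ω := Ω.isOpen.locallyCompactSpace
    have hψ' : Continuous ψ := continuous_induced_rng.2 hψ.continuous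
    exact (continuous_const (y := (⟨ω, hω.continuous⟩ : C(Ω, ℂ)))).mul
      ((ContinuousMap.continuous_precomp ⟨ψ, hψ'⟩).comp continuous_subtype_val)

/-- The punctured plane `ℂ* = ℂ ∖ {0}`. -/
def puncturedPlane : Opens ℂ := ⟨{0}ᶜ, isOpen_compl_singleton⟩

/-!
The operator is `T f = ω · (f ∘ ψ)` on the functions holomorphic on the punctured plane.

*The criterion and the dynamics.* `H(ℂ*)` is a separable, complete, metrizable group, and for such a
space the Frequent Hypercyclicity Criterion gives all the dynamical properties. Take a sequence `x_l`
in the set of the criterion that visits every member of a countable dense subset infinitely often,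
choose pairwise disjoint sets of times `A_l` of positive lower density whose elements are far apart
(`spreadSet`), and let `f = ∑_l ∑_{n ∈ A_l} S ^ n x_l`. At a time `k ∈ A_l` the image `T ^ k f` is `x_l`
up to subsums of the tails of `∑ T ^ n x_j` and `∑ S ^ n x_j`, which unconditional convergence allows
to be made as small as desired for large `l`
(`SatisfiesFHC.isFrequentlyHypercyclic`). For mixing, `x + S ^ k y` is near `x` and is sent near `y`;
for chaos, `∑_n T ^ (rn) x + x + ∑_n S ^ (rn) x` has period `r` and is near `x` for large `r`.

*Supercyclic operators have a rigid form.* The adjoint of a supercyclic operator has at most one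
eigenline: two functionals with `Φ (T f) = Λ (Φ f)` cannot be jointly onto for diagonal `Λ`
(`IsSupercyclic.not_surjective_eigenfunctionals`), and the range is dense. Density of the range
forces `ω` to have no zeros and `ψ` to be injective, whence `ψ(z) = bz` or `ψ(z) = b/z`
(`eq_mul_or_eq_div_of_injOn`). The latter has two fixed points, and evaluation at them contradicts
the obstruction. If `|b| = 1`, then the geometric means of `|ω|` over circles control the size of
the orbit on two circles in a way that a dense projective orbit would violate
(`not_isSupercyclic_of_norm_eq_one`). If `|b| ≠ 1`, write `ω(z) = z ^ m e ^ (W(z))`; the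
cohomological equation `W(z) = w₀ + V(z) - V(bz)` can be solved coefficient by coefficient, which gives
`ω(z) = c z ^ m E(z) / E(bz)` with `E = e ^ V` (`exists_exp_eq_mul_div_comp_mul`). Up to
multiplication by `E`, the operator is then a weighted shift of Laurent coefficients, and if
`|b| ^ m ≥ 1` the weights leave no multiple of `T ^ n f` close to a suitable monomial
(`not_isSupercyclic_of_order`).

*Operators of this form satisfy the criterion.* If `|b| ^ m < 1`, then `T ^ n` maps the function
`z ^ k E(z)` to a multiple of `z ^ (k + nm) E(z)`, where the factor decays like `|b| ^ (m n² / 2)`, faster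
than the monomials grow on any compact set. The inverse of `T` is an operator of the same kind. So
both series converge absolutely on the span of these functions, which is dense
(`satisfiesFHC_weightedComp`).
-/

/-! ### Separated sets of times of positive lower density -/

/-- A strictly increasing sequence of times, growing at most linearly, in which the gaps on both
sides of the `k`-th term are at least the exponent of `2` in `k`. -/
def spreadTime (k : ℕ) : ℕ :=
  padicValNat 2 k.factorial + padicValNat 2 (k - 1).factorial + k

theorem padicValNat_factorial_succ (k : ℕ) :
    padicValNat 2 (k + 1).factorial = padicValNat 2 (k + 1) + padicValNat 2 k.factorial := by
  rw [Nat.factorial_succ, padicValNat.mul (by omega) (Nat.factorial_ne_zero k)]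

theorem padicValNat_factorial_mono : Monotone fun k : ℕ => padicValNat 2 k.factorial :=
  monotone_nat_of_le_succ fun k => by
    have := padicValNat_factorial_succ k
    omega

theorem padicValNat_two_factorial_le (k : ℕ) : padicValNat 2 k.factorial ≤ k := by
  have h := sub_one_mul_padicValNat_factorial (p := 2) k
  omega

theorem spreadTime_le (k : ℕ) : spreadTime k ≤ 3 * k := by
  have h₁ := padicValNat_two_factorial_le k
  have h₂ := padicValNat_two_factorial_le (k - 1)
  unfold spreadTime
  omega

theorem spreadTime_add_le {j k : ℕ} (hj : 1 ≤ j) (hjk : j < k) :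
    spreadTime j + padicValNat 2 j + padicValNat 2 k < spreadTime k := by
  obtain ⟨j, rfl⟩ := Nat.exists_eq_add_of_le' hj
  obtain ⟨k, rfl⟩ := Nat.exists_eq_add_of_lt hjk
  have h₁ := padicValNat_factorial_succ j
  have h₂ := padicValNat_factorial_succ (j + 1 + k)
  have h₃ := padicValNat_factorial_mono (show j + 1 ≤ j + 1 + k by omega)
  simp only [spreadTime, Nat.add_sub_cancel] at *
  omega

theorem padicValNat_le_spreadTime {k : ℕ} (hk : 1 ≤ k) : padicValNat 2 k ≤ spreadTime k := by
  obtain ⟨k, rfl⟩ := Nat.exists_eq_add_of_le' hk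
  have h₁ := padicValNat_factorial_succ k
  simp only [spreadTime]
  omega

theorem spreadTime_injOn : Set.InjOn spreadTime {k | 1 ≤ k} := by
  intro j hj k hk h
  rcases lt_trichotomy j k with hjk | hjk | hjk
  · have := spreadTime_add_le hj hjk
    omega
  · exact hjk
  · have := spreadTime_add_le hk hjk
    omega

/-- The times `spreadTime k` for which the exponent of `2` in `k` is exactly `v`. -/
def spreadSet (v : ℕ) : Set ℕ :=
  {n | ∃ k : ℕ, 1 ≤ k ∧ padicValNat 2 k = v ∧ n = spreadTime k}

theorem le_of_mem_spreadSet {v n : ℕ} (h : n ∈ spreadSet v) : v ≤ n := by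
  obtain ⟨k, hk, rfl, rfl⟩ := h
  exact padicValNat_le_spreadTime hk

theorem eq_of_mem_spreadSet {v w n : ℕ} (hv : n ∈ spreadSet v) (hw : n ∈ spreadSet w) :
    v = w := by
  obtain ⟨j, hj, rfl, rfl⟩ := hv
  obtain ⟨k, hk, rfl, h⟩ := hw
  rw [spreadTime_injOn hj hk h]

theorem spreadSet_gap {v w m n : ℕ} (hm : m ∈ spreadSet v) (hn : n ∈ spreadSet w) (hmn : m < n) :
    m + v + w ≤ n := by
  obtain ⟨j, hj, rfl, rfl⟩ := hm
  obtain ⟨k, hk, rfl, rfl⟩ := hn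
  rcases lt_trichotomy j k with hjk | rfl | hjk
  · exact (spreadTime_add_le hj hjk).le
  · omega
  · have := spreadTime_add_le hk hjk
    omega

/-- A set that contains an injective sequence of at most linear growth has positive lower
density. -/
theorem liminf_density_pos {A : Set ℕ} {q : ℕ → ℕ} {C : ℕ} (hC : 0 < C)
    (hq : Function.Injective q) (hqA : ∀ t, q t ∈ A) (hqC : ∀ t, q t ≤ C * (t + 1)) :
    0 < liminf (fun N : ℕ => (({n : ℕ | n ≤ N ∧ n ∈ A}.ncard : ℝ) / ((N : ℝ) + 1))) atTop := by
  have hfin (N : ℕ) : {n : ℕ | n ≤ N ∧ n ∈ A}.Finite :=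
    (Set.finite_Iic N).subset fun n hn => hn.1
  have hupper (N : ℕ) : ({n : ℕ | n ≤ N ∧ n ∈ A}.ncard : ℝ) / ((N : ℝ) + 1) ≤ 1 := by
    rw [div_le_one (by positivity)]
    have h := Set.ncard_le_ncard (show {n : ℕ | n ≤ N ∧ n ∈ A} ⊆ Set.Iic N from fun n hn => hn.1)
      (Set.finite_Iic N)
    rw [← Finset.coe_Iic, Set.ncard_coe_finset, Nat.card_Iic] at h
    exact_mod_cast h
  have hlower (N : ℕ) (hN : 2 * C ≤ N) :
      (1 : ℝ) / (2 * C) ≤ ({n : ℕ | n ≤ N ∧ n ∈ A}.ncard : ℝ) / ((N : ℝ) + 1) := by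
    have h := Set.ncard_le_ncard (s := q '' (Finset.range (N / C) : Set ℕ))
      (t := {n : ℕ | n ≤ N ∧ n ∈ A}) (by
        rintro _ ⟨t, ht, rfl⟩
        refine ⟨(hqC t).trans ?_, hqA t⟩
        have ht' : t + 1 ≤ N / C := by simpa using ht
        exact (Nat.mul_le_mul_left C ht').trans (Nat.mul_div_le N C)) (hfin N)
    rw [Set.ncard_image_of_injective _ hq, Set.ncard_coe_finset, Finset.card_range] at h
    have h₁ : N < C * (N / C) + C := by
      have := Nat.lt_mul_div_succ N hC
      rwa [Nat.mul_add, Nat.mul_one] at this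
    have h₂ : N + 1 ≤ 2 * (C * {n : ℕ | n ≤ N ∧ n ∈ A}.ncard) := by
      have := Nat.mul_le_mul_left C h
      omega
    have h₃ : ((N : ℝ) + 1) ≤ 2 * (C * ({n : ℕ | n ≤ N ∧ n ∈ A}.ncard : ℝ)) := by
      exact_mod_cast h₂
    have hC' : (0 : ℝ) < C := by exact_mod_cast hC
    rw [div_le_div_iff₀ (by positivity) (by positivity)]
    linarith
  refine lt_of_lt_of_le (b := (1 : ℝ) / (2 * C)) (by positivity) ?_
  refine le_liminf_of_le ?_ (eventually_atTop.2 ⟨2 * C, hlower⟩)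
  exact (isBoundedUnder_of ⟨1, hupper⟩).isCoboundedUnder_ge

theorem liminf_density_pos_of_spreadSet_subset {A : Set ℕ} {v : ℕ} (h : spreadSet v ⊆ A) :
    0 < liminf (fun N : ℕ => (({n : ℕ | n ≤ N ∧ n ∈ A}.ncard : ℝ) / ((N : ℝ) + 1))) atTop := by
  have hpos (t : ℕ) : 1 ≤ 2 ^ v * (2 * t + 1) := Nat.mul_pos (by positivity) (by omega)
  refine liminf_density_pos (q := fun t => spreadTime (2 ^ v * (2 * t + 1))) (C := 6 * 2 ^ v)
    (by positivity) ?_ (fun t => h ⟨_, hpos t, ?_, rfl⟩) fun t => (spreadTime_le _).trans ?_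
  · intro s t hst
    have := spreadTime_injOn (hpos s) (hpos t) hst
    have := Nat.eq_of_mul_eq_mul_left (by positivity) this
    omega
  · rw [padicValNat.mul (by positivity) (by omega), padicValNat.prime_pow,
      padicValNat.eq_zero_of_not_dvd (by omega), add_zero]
  · nlinarith [Nat.zero_le (2 ^ v)]

/-! ### Sums of small vectors -/

section SmallSums

variable {X : Type*} [AddCommGroup X]

theorem sum_range_mem_of_add_subset {U : ℕ → Set X} (h0 : ∀ n, (0 : X) ∈ U n)
    (hU : ∀ n, ∀ x ∈ U (n + 1), ∀ y ∈ U (n + 1), x + y ∈ U n) (k l : ℕ) (v : ℕ → X)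
    (hv : ∀ j < k, v j ∈ U (l + j + 1)) : ∑ j ∈ Finset.range k, v j ∈ U l := by
  induction k generalizing l v with
  | zero => simpa using h0 l
  | succ k ih =>
    rw [Finset.sum_range_succ']
    refine hU l _ (ih (l + 1) (fun j => v (j + 1)) fun j hj => ?_) _ ?_
    · convert hv (j + 1) (by omega) using 2
      omega
    · exact hv 0 (by omega)

theorem sum_mem_of_add_subset {U : ℕ → Set X} (h0 : ∀ n, (0 : X) ∈ U n)
    (hU : ∀ n, ∀ x ∈ U (n + 1), ∀ y ∈ U (n + 1), x + y ∈ U n) (l : ℕ) (F : Finset ℕ) (v : ℕ → X)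
    (hv : ∀ j ∈ F, v j ∈ U (l + j + 1)) : ∑ j ∈ F, v j ∈ U l := by
  classical
  obtain ⟨k, hk⟩ := F.exists_nat_subset_range
  have h : ∑ j ∈ Finset.range k, (if j ∈ F then v j else 0) = ∑ j ∈ F, v j := by
    rw [← Finset.sum_filter, Finset.filter_mem_eq_inter, Finset.inter_eq_right.2 hk]
  rw [← h]
  refine sum_range_mem_of_add_subset h0 hU k l _ fun j _ => ?_
  split_ifs with hj
  · exact hv j hj
  · exact h0 _

/-- If the sums of `v j n` over finite sets of indices `n ≥ N l` are small of order `l + j + 1` for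
all `j ≤ l`, then a finite sum over pairs `(j, n)` with `n ≥ N l` and `n ≥ N j` is small of
order `l`. The second index is allowed to be a function `g` of the pair. -/
theorem sum_pairs_mem {U : ℕ → Set X} (h0 : ∀ n, (0 : X) ∈ U n) (hanti : Antitone U)
    (hU : ∀ n, ∀ x ∈ U (n + 1), ∀ y ∈ U (n + 1), x + y ∈ U n) {v : ℕ → ℕ → X} {N : ℕ → ℕ}
    (hv : ∀ l, ∀ j ≤ l, ∀ F : Finset ℕ, (∀ n ∈ F, N l ≤ n) → ∑ n ∈ F, v j n ∈ U (l + j + 1))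
    (l : ℕ) (F : Finset (ℕ × ℕ)) (g : ℕ × ℕ → ℕ)
    (hg : ∀ p ∈ F, ∀ q ∈ F, p.1 = q.1 → g p = g q → p = q)
    (hF : ∀ p ∈ F, N l ≤ g p ∧ N p.1 ≤ g p) :
    ∑ p ∈ F, v p.1 (g p) ∈ U l := by
  classical
  rw [← Finset.sum_fiberwise_of_maps_to (s := F) (t := F.image Prod.fst) (g := Prod.fst)
    fun p hp => Finset.mem_image_of_mem _ hp]
  refine sum_mem_of_add_subset h0 hU l _ _ fun j _ => ?_
  have h : ∑ p ∈ F with p.1 = j, v p.1 (g p) =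
      ∑ n ∈ (F.filter fun p => p.1 = j).image g, v j n := by
    rw [Finset.sum_image]
    · refine Finset.sum_congr rfl fun p hp => ?_
      rw [(Finset.mem_filter.1 hp).2]
    · intro p hp q hq h
      simp only [Finset.coe_filter, Set.mem_ofPred_eq] at hp hq
      exact hg p hp.1 q hq.1 (hp.2.trans hq.2.symm) h
  rw [h]
  rcases le_total j l with hjl | hjl
  · refine hv l j hjl _ fun n hn => ?_
    obtain ⟨p, hp, rfl⟩ := Finset.mem_image.1 hn
    exact (hF p (Finset.mem_filter.1 hp).1).1
  · refine hanti (show l + j + 1 ≤ j + j + 1 by omega) (hv j j le_rfl _ fun n hn => ?_)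
    obtain ⟨p, hp, rfl⟩ := Finset.mem_image.1 hn
    obtain ⟨hpF, rfl⟩ := Finset.mem_filter.1 hp
    exact (hF p hpF).2

theorem tail_sum_mem [TopologicalSpace X] [IsTopologicalAddGroup X] {v : ℕ → X} (hv : Summable v)
    {U : Set X} (hU : U ∈ 𝓝 0) :
    ∀ᶠ N in atTop, ∀ F : Finset ℕ, (∀ n ∈ F, N ≤ n) → ∑ n ∈ F, v n ∈ U := by
  obtain ⟨s, hs⟩ := hv.vanishing hU
  obtain ⟨M, hM⟩ := s.exists_nat_subset_range
  refine eventually_atTop.2 ⟨M, fun N hN F hF => hs F ?_⟩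
  refine Finset.disjoint_left.2 fun n hn hns => ?_
  have h₁ := hF n hn
  have h₂ := Finset.mem_range.1 (hM hns)
  omega

theorem mem_of_mem_closure [TopologicalSpace X] [IsTopologicalAddGroup X] {U : ℕ → Set X}
    (hnhds : ∀ n, U n ∈ 𝓝 (0 : X)) (hU : ∀ n, ∀ x ∈ U (n + 1), ∀ y ∈ U (n + 1), x + y ∈ U n)
    {A : Set X} {n : ℕ} (hA : A ⊆ U (n + 1)) {x : X} (hx : x ∈ closure A) : x ∈ U n := by
  have h : {y | x - y ∈ U (n + 1)} ∈ 𝓝 x :=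
    (continuous_const.sub continuous_id).continuousAt.preimage_mem_nhds (by simpa using hnhds _)
  obtain ⟨y, hy, hyA⟩ := mem_closure_iff_nhds.1 hx _ h
  simpa using hU n _ hy _ (hA hyA)

end SmallSums

/-! ### Consequences of the Frequent Hypercyclicity Criterion -/

section Criterion

variable {X : Type*} [AddCommGroup X] [Module ℂ X]

section Iterates

variable [TopologicalSpace X] {T : X →L[ℂ] X} {X₀ : Set X} {S : X₀ → X₀}

theorem iterate_add_iterate_rightInverse (hS : ∀ f : X₀, T (S f : X) = f) (n k : ℕ) (f : X₀) :
    T^[n] (S^[n + k] f : X) = S^[k] f := by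
  induction n with
  | zero => simp
  | succ n ih =>
    rw [Function.iterate_succ_apply, show n + 1 + k = (n + k) + 1 by omega,
      Function.iterate_succ_apply', hS, ih]

theorem iterate_iterate_rightInverse_of_le (hS : ∀ f : X₀, T (S f : X) = f) {n i : ℕ} (h : i ≤ n)
    (f : X₀) : T^[n] (S^[i] f : X) = T^[n - i] (f : X) := by
  obtain ⟨k, rfl⟩ := Nat.exists_eq_add_of_le h
  have := iterate_add_iterate_rightInverse hS i 0 f
  rw [add_comm i k, Function.iterate_add_apply, Nat.add_sub_cancel]
  simpa using congrArg T^[k] this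

theorem iterate_iterate_rightInverse_of_ge (hS : ∀ f : X₀, T (S f : X) = f) {n i : ℕ} (h : n ≤ i)
    (f : X₀) : T^[n] (S^[i] f : X) = S^[i - n] f := by
  obtain ⟨k, rfl⟩ := Nat.exists_eq_add_of_le h
  rw [iterate_add_iterate_rightInverse hS, Nat.add_sub_cancel_left]

end Iterates

/-- A frequently hypercyclic vector is `∑_l ∑_n S^n (y l)`, where `n` runs through the `l`-th separated
set of times. The separation is chosen along with `l`, so that at a time in the `l`-th set the other
terms form small subsums of the tails of `∑ T^n (y j)` and `∑ S^n (y j)`. -/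
theorem SatisfiesFHC.isFrequentlyHypercyclic [UniformSpace X] [IsUniformAddGroup X]
    [CompleteSpace X] [T2Space X] [SecondCountableTopology X] {T : X →L[ℂ] X}
    (hT : SatisfiesFHC T) : IsFrequentlyHypercyclic T := by
  classical
  obtain ⟨X₀, hX₀, S, hTS⟩ := hT
  have hS : ∀ f : X₀, T (S f : X) = f := fun f => (hTS f).2.2
  obtain ⟨U, hbasis, hU'⟩ := IsTopologicalAddGroup.exists_antitone_basis_nhds_zero X
  have hU : ∀ n, ∀ x ∈ U (n + 1), ∀ y ∈ U (n + 1), x + y ∈ U n :=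
    fun n x hx y hy => hU' n (Set.add_mem_add hx hy)
  have hnhds : ∀ n, U n ∈ 𝓝 (0 : X) := fun n => hbasis.1.mem_of_mem trivial
  have h0 : ∀ n, (0 : X) ∈ U n := fun n => mem_of_mem_nhds (hnhds n)
  have : Nonempty X₀ := hX₀.nonempty.to_subtype
  obtain ⟨d, hd⟩ := exists_dense_seq X₀
  have hd' : DenseRange fun k => (d k : X) :=
    hX₀.denseRange_val.comp hd continuous_subtype_val
  -- Every vector of the dense sequence `d` occurs infinitely often in the sequence `y`.
  let y : ℕ → X₀ := fun l => d (Nat.unpair l).1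
  have hTsum (f : X₀) : Summable fun n => T^[n] (f : X) :=
    (summable_nat_add_iff 1).1 (hTS f).1
  have hSsum (f : X₀) : Summable fun n => (S^[n] f : X) :=
    (summable_nat_add_iff (f := fun n => (S^[n] f : X)) 1).1 (hTS f).2.1
  obtain ⟨N, hNmono, hN⟩ : ∃ N : ℕ → ℕ, StrictMono N ∧ ∀ l, ∀ j ≤ l,
      (∀ F : Finset ℕ, (∀ n ∈ F, N l ≤ n) → ∑ n ∈ F, T^[n] (y j : X) ∈ U (l + j + 1)) ∧
      (∀ F : Finset ℕ, (∀ n ∈ F, N l ≤ n) → ∑ n ∈ F, (S^[n] (y j) : X) ∈ U (l + j + 1)) := by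
    refine extraction_forall_of_eventually (P := fun l M => ∀ j ≤ l,
      (∀ F : Finset ℕ, (∀ n ∈ F, M ≤ n) → ∑ n ∈ F, T^[n] (y j : X) ∈ U (l + j + 1)) ∧
      (∀ F : Finset ℕ, (∀ n ∈ F, M ≤ n) → ∑ n ∈ F, (S^[n] (y j) : X) ∈ U (l + j + 1)))
      fun l => ?_
    exact (Set.finite_Iic l).eventually_all.2 fun j _ =>
      (tail_sum_mem (hTsum (y j)) (hnhds _)).and (tail_sum_mem (hSsum (y j)) (hnhds _))
  have hNT := fun l j hj => (hN l j hj).1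
  have hNS := fun l j hj => (hN l j hj).2
  let term : ℕ × ℕ → X := fun p => if p.2 ∈ spreadSet (N p.1) then S^[p.2] (y p.1) else 0
  have hterm : Summable term := by
    refine summable_iff_vanishing.2 fun e he => ?_
    obtain ⟨l, hl⟩ := hbasis.1.mem_iff.1 he
    refine ⟨Finset.range (l + 1) ×ˢ Finset.range (N l), fun F hF => hl.2 ?_⟩
    rw [← Finset.sum_filter]
    refine sum_pairs_mem h0 hbasis.2 hU hNS l _ Prod.snd ?_ ?_
    · exact fun p _ q _ h₁ h₂ => Prod.ext h₁ h₂
    · intro p hp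
      obtain ⟨hpF, hpA⟩ := Finset.mem_filter.1 hp
      have h₁ := le_of_mem_spreadSet hpA
      refine ⟨?_, h₁⟩
      have h₂ := Finset.disjoint_left.1 hF hpF
      rw [Finset.mem_product, Finset.mem_range, Finset.mem_range, not_and_or] at h₂
      rcases h₂ with h₂ | h₂
      · exact (hNmono.monotone (by omega)).trans h₁
      · omega
  obtain ⟨x, hx⟩ := hterm
  have key (l n : ℕ) (hn : n ∈ spreadSet (N (l + 2))) :
      T^[n] x - (y (l + 2) : X) ∈ U l := by
    have hTx : HasSum (fun p => T^[n] (term p)) (T^[n] x) := by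
      rw [← FunLike.coe_pow_eq_iterate]
      exact (T ^ n).hasSum hx
    have hTx' : Tendsto (fun F : Finset (ℕ × ℕ) => ∑ p ∈ F, T^[n] (term p) - (y (l + 2) : X))
        atTop (𝓝 (T^[n] x - (y (l + 2) : X))) := Tendsto.sub_const hTx _
    refine mem_of_mem_closure hnhds hU subset_rfl (mem_closure_of_tendsto hTx' ?_)
    filter_upwards [eventually_ge_atTop {((l + 2, n) : ℕ × ℕ)}] with F hF
    have hmem : ((l + 2, n) : ℕ × ℕ) ∈ F := by simpa using hF
    have hmain : T^[n] (term (l + 2, n)) = y (l + 2) := by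
      simp only [term, if_pos hn]
      simpa using iterate_iterate_rightInverse_of_le hS le_rfl (y (l + 2))
    have hzero : T^[n] (0 : X) = 0 := by
      rw [← FunLike.coe_pow_eq_iterate, map_zero]
    rw [← Finset.add_sum_erase F _ hmem, hmain, add_sub_cancel_left]
    -- The times before `n` contribute iterates of `T`, the times after `n` iterates of `S`.
    have hsplit : ∑ p ∈ F.erase (l + 2, n), T^[n] (term p) =
        ∑ p ∈ (F.erase (l + 2, n)).filter (fun p => p.2 ∈ spreadSet (N p.1)) with p.2 < n,
          T^[n - p.2] (y p.1 : X) +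
        ∑ p ∈ (F.erase (l + 2, n)).filter (fun p => p.2 ∈ spreadSet (N p.1)) with ¬ p.2 < n,
          (S^[p.2 - n] (y p.1) : X) := by
      have h₁ : ∑ p ∈ F.erase (l + 2, n), T^[n] (term p) =
          ∑ p ∈ (F.erase (l + 2, n)).filter (fun p => p.2 ∈ spreadSet (N p.1)),
            T^[n] (S^[p.2] (y p.1) : X) := by
        rw [Finset.sum_filter]
        refine Finset.sum_congr rfl fun p _ => ?_
        simp only [term]
        split_ifs <;> simp [hzero]
      rw [h₁, ← Finset.sum_filter_add_sum_filter_not _ (fun p : ℕ × ℕ => p.2 < n)]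
      congr 1
      · refine Finset.sum_congr rfl fun p hp => ?_
        exact iterate_iterate_rightInverse_of_le hS (Finset.mem_filter.1 hp).2.le _
      · refine Finset.sum_congr rfl fun p hp => ?_
        exact iterate_iterate_rightInverse_of_ge hS (not_lt.1 (Finset.mem_filter.1 hp).2) _
    rw [hsplit]
    refine hU _ _ (sum_pairs_mem h0 hbasis.2 hU hNT (l + 2) _ (fun p => n - p.2) ?_ ?_) _
      (sum_pairs_mem h0 hbasis.2 hU hNS (l + 2) _ (fun p => p.2 - n) ?_ ?_)
    · intro p hp q hq h₁ h₂
      have := (Finset.mem_filter.1 hp).2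
      have := (Finset.mem_filter.1 hq).2
      exact Prod.ext h₁ (by omega)
    · intro p hp
      obtain ⟨hp, hpn⟩ := Finset.mem_filter.1 hp
      have := spreadSet_gap (Finset.mem_filter.1 hp).2 hn hpn
      constructor <;> omega
    · intro p hp q hq h₁ h₂
      have := (Finset.mem_filter.1 hp).2
      have := (Finset.mem_filter.1 hq).2
      exact Prod.ext h₁ (by omega)
    · intro p hp
      obtain ⟨hp, hpn⟩ := Finset.mem_filter.1 hp
      obtain ⟨hpF, hpA⟩ := Finset.mem_filter.1 hp
      have hne : n ≠ p.2 := by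
        intro h
        refine Finset.ne_of_mem_erase hpF (Prod.ext ?_ h.symm)
        exact (hNmono.injective (eq_of_mem_spreadSet hn (h ▸ hpA))).symm
      have := spreadSet_gap hn hpA (by omega)
      constructor <;> omega
  refine ⟨x, fun V hV hVne => ?_⟩
  obtain ⟨k, hk⟩ := hd'.exists_mem_open hV hVne
  have hV' : {z | (d k : X) + z ∈ V} ∈ 𝓝 (0 : X) :=
    (continuous_const.add continuous_id).continuousAt.preimage_mem_nhds
      (hV.mem_nhds (by simpa using hk))
  obtain ⟨l₀, -, hl₀⟩ := hbasis.1.mem_iff.1 hV'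
  obtain ⟨l, hl⟩ := Nat.exists_eq_add_of_le (Nat.right_le_pair k (l₀ + 2))
  have hy : y (l₀ + l + 2) = d k := by
    rw [show l₀ + l + 2 = Nat.pair k (l₀ + 2) by omega]
    simp [y]
  refine liminf_density_pos_of_spreadSet_subset (A := {n | T^[n] x ∈ V})
    (v := N (l₀ + l + 2)) fun n hn => ?_
  have := hl₀ (hbasis.2 (Nat.le_add_right l₀ l) (key (l₀ + l) n hn))
  rw [hy] at this
  simpa using this

theorem SatisfiesFHC.isTopMixing [TopologicalSpace X] [IsTopologicalAddGroup X] {T : X →L[ℂ] X}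
    (hT : SatisfiesFHC T) : IsTopMixing T := by
  obtain ⟨X₀, hX₀, S, hTS⟩ := hT
  have hS : ∀ f : X₀, T (S f : X) = f := fun f => (hTS f).2.2
  intro U V hU hUne hV hVne
  obtain ⟨f, hfU, hf⟩ := hX₀.inter_open_nonempty U hU hUne
  obtain ⟨g, hgV, hg⟩ := hX₀.inter_open_nonempty V hV hVne
  have h₁ : Tendsto (fun n => T^[n] f) atTop (𝓝 0) :=
    (tendsto_add_atTop_iff_nat 1).1 (hTS ⟨f, hf⟩).1.tendsto_atTop_zero
  have h₂ : Tendsto (fun n => (S^[n] ⟨g, hg⟩ : X)) atTop (𝓝 0) :=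
    (tendsto_add_atTop_iff_nat (f := fun n => (S^[n] ⟨g, hg⟩ : X)) 1).1
      (hTS ⟨g, hg⟩).2.1.tendsto_atTop_zero
  have h₃ := (h₂.const_add f).eventually_mem (hU.mem_nhds (by simpa using hfU))
  have h₄ := (h₁.add_const g).eventually_mem (hV.mem_nhds (by simpa using hgV))
  obtain ⟨n, hn⟩ := eventually_atTop.1 (h₃.and h₄)
  refine ⟨n, fun k hk => ⟨_, ⟨_, (hn k hk).1, ?_⟩, (hn k hk).2⟩⟩
  rw [← FunLike.coe_pow_eq_iterate, map_add, FunLike.coe_pow_eq_iterate]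
  simpa using iterate_iterate_rightInverse_of_le hS (le_refl k) ⟨g, hg⟩

/-- The vectors `∑_{n ≥ 1} T^{nr} f + f + ∑_{n ≥ 1} S^{nr} f`, for `f ∈ X₀` and large `r`, are
periodic points close to `f`. -/
theorem SatisfiesFHC.isChaotic [UniformSpace X] [IsUniformAddGroup X] [CompleteSpace X]
    [T2Space X] {T : X →L[ℂ] X} (hT : SatisfiesFHC T) : IsChaotic T := by
  have hmix := hT.isTopMixing
  refine ⟨fun U V hU hUne hV hVne => ?_, ?_⟩
  · obtain ⟨n, hn⟩ := hmix U V hU hUne hV hVne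
    exact ⟨n, hn n le_rfl⟩
  obtain ⟨X₀, hX₀, S, hTS⟩ := hT
  have hS : ∀ f : X₀, T (S f : X) = f := fun f => (hTS f).2.2
  rw [dense_iff_inter_open]
  intro U hU hUne
  obtain ⟨f, hfU, hf⟩ := hX₀.inter_open_nonempty U hU hUne
  have hTsum : Summable fun n => T^[n] f := (summable_nat_add_iff 1).1 (hTS ⟨f, hf⟩).1
  have hSsum : Summable fun n => (S^[n] ⟨f, hf⟩ : X) :=
    (summable_nat_add_iff (f := fun n => (S^[n] ⟨f, hf⟩ : X)) 1).1 (hTS ⟨f, hf⟩).2.1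
  have hW : {z | f + z ∈ U} ∈ 𝓝 (0 : X) :=
    (continuous_const.add continuous_id).continuousAt.preimage_mem_nhds
      (hU.mem_nhds (by simpa using hfU))
  obtain ⟨W, hWopen, hW0, hWU⟩ := exists_open_nhds_zero_add_subset hW
  obtain ⟨C, ⟨hC, hCclosed⟩, hCW⟩ := (closed_nhds_basis (0 : X)).mem_iff.1 (hWopen.mem_nhds hW0)
  obtain ⟨N, hNT, hNS⟩ := ((tail_sum_mem hTsum hC).and (tail_sum_mem hSsum hC)).exists
  have hinj {r : ℕ} (hr : 0 < r) : Function.Injective fun n : ℕ => (n + 1) * r :=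
    fun m n h => by simpa [hr.ne'] using h
  obtain ⟨r, hr, hNr⟩ : ∃ r, 0 < r ∧ N ≤ r := ⟨N + 1, by omega, by omega⟩
  have htail {v : ℕ → X} (hv : Summable v)
      (hvN : ∀ F : Finset ℕ, (∀ n ∈ F, N ≤ n) → ∑ n ∈ F, v n ∈ C) :
      ∑' n, v ((n + 1) * r) ∈ C := by
    refine hCclosed.mem_of_tendsto (hv.comp_injective (hinj hr)).hasSum (Eventually.of_forall ?_)
    intro F
    classical
    simp only [Function.comp_apply]
    rw [← Finset.sum_image (f := v) (g := fun n => (n + 1) * r) (hinj hr).injOn]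
    refine hvN _ fun n hn => ?_
    obtain ⟨m, -, rfl⟩ := Finset.mem_image.1 hn
    nlinarith
  let a := ∑' n, T^[(n + 1) * r] f
  let b := ∑' n, (S^[(n + 1) * r] ⟨f, hf⟩ : X)
  refine ⟨f + (a + b), hWU (Set.add_mem_add (hCW (htail hTsum hNT))
    (hCW (htail (v := fun n => (S^[n] ⟨f, hf⟩ : X)) hSsum hNS))),
    Function.mk_mem_periodicPts hr ?_⟩
  have hTa : T^[r] f + T^[r] a = a := by
    have h₁ : Summable fun n => T^[(n + 1) * r] f := hTsum.comp_injective (hinj hr)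
    have h₂ : a = T^[(0 + 1) * r] f + ∑' n, T^[(n + 1 + 1) * r] f := h₁.tsum_eq_zero_add
    have h₃ : T^[r] a = ∑' n, T^[(n + 1 + 1) * r] f := by
      rw [← FunLike.coe_pow_eq_iterate, (T ^ r).map_tsum h₁, FunLike.coe_pow_eq_iterate]
      refine tsum_congr fun n => ?_
      rw [← Function.iterate_add_apply]
      congr 2
      ring
    rw [h₃]
    simpa using h₂.symm
  have hTb : T^[r] b = f + b := by
    have h₁ : Summable fun n => (S^[(n + 1) * r] ⟨f, hf⟩ : X) :=
      hSsum.comp_injective (hinj hr)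
    have h₂ : Summable fun n => (S^[n * r] ⟨f, hf⟩ : X) :=
      hSsum.comp_injective fun m n h => by simpa [hr.ne'] using h
    have h₃ : T^[r] b = ∑' n, (S^[n * r] ⟨f, hf⟩ : X) := by
      rw [← FunLike.coe_pow_eq_iterate, (T ^ r).map_tsum h₁, FunLike.coe_pow_eq_iterate]
      refine tsum_congr fun n => ?_
      rw [iterate_iterate_rightInverse_of_ge hS (by nlinarith)]
      congr 2
      rw [Nat.succ_mul, Nat.add_sub_cancel]
    rw [h₃, h₂.tsum_eq_zero_add]
    simp [b]
  have hadd : T^[r] (f + (a + b)) = T^[r] f + T^[r] a + T^[r] b := by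
    rw [← FunLike.coe_pow_eq_iterate, map_add, map_add, add_assoc]
  rw [Function.IsPeriodicPt, Function.IsFixedPt, hadd, hTa, hTb]
  abel

end Criterion

/-! ### Hypercyclic and supercyclic operators -/

section Supercyclic

variable {X : Type*} [AddCommMonoid X] [Module ℂ X] [TopologicalSpace X] {T : X →L[ℂ] X}

theorem IsFrequentlyHypercyclic.isHypercyclic (hT : IsFrequentlyHypercyclic T) :
    IsHypercyclic T := by
  obtain ⟨f, hf⟩ := hT
  refine ⟨f, dense_iff_inter_open.2 fun U hU hUne => ?_⟩
  have h := hf U hU hUne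
  by_contra hempty
  have hnot (n : ℕ) : T^[n] f ∉ U := fun hn => hempty ⟨_, hn, n, rfl⟩
  simp [hnot] at h

theorem IsHypercyclic.isSupercyclic (hT : IsHypercyclic T) : IsSupercyclic T := by
  obtain ⟨f, hf⟩ := hT
  refine ⟨f, hf.mono ?_⟩
  rintro g ⟨n, rfl⟩
  exact ⟨1, n, (one_smul _ _).symm⟩

theorem apply_iterate_of_comp_eq_smul (φ : X →L[ℂ] ℂ) {μ : ℂ} (h : ∀ f, φ (T f) = μ * φ f) (n : ℕ)
    (f : X) : φ (T^[n] f) = μ ^ n * φ f := by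
  induction n with
  | zero => simp
  | succ n ih => rw [Function.iterate_succ_apply', h, ih, pow_succ']; ring

/-- A supercyclic operator has no pair of eigenfunctionals that jointly map onto `ℂ²`: the
quotients of their values along an orbit are the powers of one number, up to a constant factor, and
these stay bounded or stay away from zero. -/
theorem IsSupercyclic.not_surjective_eigenfunctionals (hT : IsSupercyclic T) {φ χ : X →L[ℂ] ℂ}
    {μ ν : ℂ} (hφ : ∀ f, φ (T f) = μ * φ f) (hχ : ∀ f, χ (T f) = ν * χ f) :
    ∃ s t : ℂ, ∀ f, ¬ (φ f = s ∧ χ f = t) := by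
  by_contra! hsurj
  obtain ⟨f, hf⟩ := hT
  -- One of the two functionals has the larger growth; its size is bounded below by the other.
  wlog hμν : ‖μ‖ ≤ ‖ν‖ generalizing φ χ μ ν
  · refine this hχ hφ (fun s t => ?_) (le_of_not_ge hμν)
    obtain ⟨g, hg⟩ := hsurj t s
    exact ⟨g, hg.symm⟩
  obtain ⟨δ, hδ, hδf⟩ : ∃ δ > 0, ∀ g ∈ {g : X | ∃ (c : ℂ) (n : ℕ), g = c • T^[n] f},
      δ * ‖φ g‖ ≤ ‖χ g‖ := by
    have hχf : χ f ≠ 0 := by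
      intro h
      obtain ⟨g, -, hg⟩ := hsurj 0 1
      have hopen : IsOpen {g | χ g ≠ 0} := isOpen_ne_fun χ.continuous continuous_const
      obtain ⟨_, hx, c, n, rfl⟩ := hf.inter_open_nonempty _ hopen ⟨g, by simp [hg]⟩
      apply hx
      rw [map_smul, apply_iterate_of_comp_eq_smul χ hχ, h, mul_zero, smul_zero]
    refine ⟨‖χ f‖ / (‖φ f‖ + 1), by positivity, ?_⟩
    rintro g ⟨c, n, rfl⟩
    rw [map_smul, map_smul, apply_iterate_of_comp_eq_smul χ hχ,
      apply_iterate_of_comp_eq_smul φ hφ, norm_smul, norm_smul, norm_mul, norm_mul, norm_pow,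
      norm_pow, div_mul_eq_mul_div, div_le_iff₀ (by positivity)]
    have h₁ : ‖μ‖ ^ n ≤ ‖ν‖ ^ n := pow_le_pow_left₀ (norm_nonneg _) hμν n
    calc ‖χ f‖ * (‖c‖ * (‖μ‖ ^ n * ‖φ f‖))
        ≤ ‖χ f‖ * (‖c‖ * (‖ν‖ ^ n * (‖φ f‖ + 1))) := by gcongr; linarith
      _ = ‖c‖ * (‖ν‖ ^ n * ‖χ f‖) * (‖φ f‖ + 1) := by ring
  obtain ⟨g, hg₁, hg₂⟩ := hsurj 1 0
  have hclosed : IsClosed {g | δ * ‖φ g‖ ≤ ‖χ g‖} :=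
    isClosed_le (continuous_const.mul φ.continuous.norm) χ.continuous.norm
  have h : g ∈ {g | δ * ‖φ g‖ ≤ ‖χ g‖} := by
    have := hclosed.closure_subset_iff.2 hδf (hf g)
    exact this
  have : δ * ‖φ g‖ ≤ ‖χ g‖ := h
  rw [hg₁, hg₂] at this
  simp at this
  linarith

end Supercyclic

/-! ### The topological vector space of holomorphic functions -/

section HoloSpace

variable {Ω : Opens ℂ}

/-- The extension of a function on `Ω` to the plane, by zero outside `Ω`. -/
noncomputable def zeroExtend (f : Ω → ℂ) : ℂ → ℂ :=
  Function.extend Subtype.val f 0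

theorem zeroExtend_apply (f : Ω → ℂ) (z : Ω) : zeroExtend f z = f z :=
  Subtype.val_injective.extend_apply f 0 z

theorem zeroExtend_of_mem (f : Ω → ℂ) {z : ℂ} (hz : z ∈ Ω) : zeroExtend f z = f ⟨z, hz⟩ :=
  zeroExtend_apply f ⟨z, hz⟩

theorem IsHolo.differentiableOn_zeroExtend {f : Ω → ℂ} (hf : IsHolo Ω f) :
    DifferentiableOn ℂ (zeroExtend f) Ω := by
  obtain ⟨F, hF, h⟩ := hf
  exact hF.congr fun z hz => by rw [zeroExtend_of_mem f hz, h]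

theorem isHolo_iff_differentiableOn_zeroExtend {f : Ω → ℂ} :
    IsHolo Ω f ↔ DifferentiableOn ℂ (zeroExtend f) Ω :=
  ⟨fun hf => hf.differentiableOn_zeroExtend,
    fun hf => ⟨zeroExtend f, hf, fun z => (zeroExtend_apply f z).symm⟩⟩

noncomputable instance : CoeFun (HoloSpace Ω) fun _ => Ω → ℂ := ⟨fun f => f.1⟩

theorem HoloSpace.isHolo (f : HoloSpace Ω) : IsHolo Ω f := f.2

/-- The element of `H(Ω)` defined by a function that is differentiable on `Ω`. -/
noncomputable def HoloSpace.mk (F : ℂ → ℂ) (hF : DifferentiableOn ℂ F Ω) : HoloSpace Ω :=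
  ⟨⟨fun z => F z, (IsHolo.continuous ⟨F, hF, fun _ => rfl⟩ : Continuous fun z : Ω => F z)⟩,
    F, hF, fun _ => rfl⟩

@[simp] theorem HoloSpace.mk_apply (F : ℂ → ℂ) (hF : DifferentiableOn ℂ F Ω) (z : Ω) :
    HoloSpace.mk F hF z = F z := rfl

@[simp] theorem HoloSpace.smul_apply (c : ℂ) (f : HoloSpace Ω) (z : Ω) : (c • f) z = c * f z := rfl

@[simp] theorem weightedComp_apply (ω : Ω → ℂ) (hω : IsHolo Ω ω) (ψ : Ω → Ω)
    (hψ : IsHolo Ω (fun z => (ψ z : ℂ))) (f : HoloSpace Ω) (z : Ω) :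
    weightedComp ω hω ψ hψ f z = ω z * f (ψ z) := rfl

/-- Evaluation at a point, as a continuous functional on `H(Ω)`. -/
noncomputable def HoloSpace.evalCLM (z : Ω) : HoloSpace Ω →L[ℂ] ℂ :=
  (ContinuousMap.evalCLM ℂ z).comp (HoloSpace Ω).subtypeL

@[simp] theorem HoloSpace.evalCLM_apply (z : Ω) (f : HoloSpace Ω) :
    HoloSpace.evalCLM z f = f z := rfl

theorem isClosed_holoSpace (Ω : Opens ℂ) : IsClosed (HoloSpace Ω : Set C(Ω, ℂ)) := by
  have : LocallyCompactSpace Ω := Ω.isOpen.locallyCompactSpace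
  refine isClosed_of_closure_subset fun f hf => ?_
  have hne : (𝓝[(HoloSpace Ω : Set C(Ω, ℂ))] f).NeBot := mem_closure_iff_nhdsWithin_neBot.1 hf
  have h : TendstoLocallyUniformly (fun (g : C(Ω, ℂ)) (z : Ω) => g z) f
      (𝓝[(HoloSpace Ω : Set C(Ω, ℂ))] f) :=
    ContinuousMap.tendsto_iff_tendstoLocallyUniformly.1 (tendsto_id'.2 nhdsWithin_le_nhds)
  have h' : TendstoLocallyUniformlyOn (fun (g : C(Ω, ℂ)) => zeroExtend g) (zeroExtend f)
      (𝓝[(HoloSpace Ω : Set C(Ω, ℂ))] f) Ω := by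
    rw [tendstoLocallyUniformlyOn_iff_tendstoLocallyUniformly_comp_coe]
    convert! h using 2 with g
    · ext z
      exact zeroExtend_apply _ z
    · ext z
      exact zeroExtend_apply _ z
  refine isHolo_iff_differentiableOn_zeroExtend.2 (h'.differentiableOn ?_ Ω.isOpen)
  exact eventually_mem_nhdsWithin.mono fun g hg => IsHolo.differentiableOn_zeroExtend hg

instance : CompleteSpace (HoloSpace Ω) := by
  have : LocallyCompactSpace Ω := Ω.isOpen.locallyCompactSpace
  exact (isClosed_holoSpace Ω).completeSpace_coe

instance : SecondCountableTopology (HoloSpace Ω) := by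
  have : LocallyCompactSpace Ω := Ω.isOpen.locallyCompactSpace
  exact Topology.IsInducing.subtypeVal.secondCountableTopology

instance : IsUniformAddGroup (HoloSpace Ω) :=
  IsUniformInducing.isUniformAddGroup
    (AddMonoidHom.mk' (fun f : HoloSpace Ω => ContinuousMap.toUniformOnFunIsCompact f.1)
      fun _ _ => rfl)
    (ContinuousMap.isUniformEmbedding_toUniformOnFunIsCompact.isUniformInducing.comp
      (isUniformInducing_val _))

instance : ContinuousAdd (HoloSpace Ω) :=
  (inferInstance : IsTopologicalAddGroup (HoloSpace Ω)).toContinuousAdd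

/-- The Weierstrass test in `H(Ω)`: a pointwise convergent series that is dominated on each compact
set by a convergent series of constants converges unconditionally in `H(Ω)`. -/
theorem HoloSpace.summable_of_norm_le {ι : Type*} {x : ι → HoloSpace Ω}
    (h : ∀ K : Set Ω, IsCompact K → ∃ u : ι → ℝ, Summable u ∧ ∀ i, ∀ z ∈ K, ‖x i z‖ ≤ u i) :
    Summable x := by
  have : LocallyCompactSpace Ω := Ω.isOpen.locallyCompactSpace
  have hs : Summable fun i => (x i : C(Ω, ℂ)) := by
    refine ContinuousMap.summable_of_locally_summable_norm fun K => ?_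
    obtain ⟨u, hu, hxu⟩ := h K K.isCompact
    have hu' : Summable fun i => |u i| := hu.abs
    refine hu'.of_nonneg_of_le (fun i => norm_nonneg _) fun i => ?_
    exact (ContinuousMap.norm_le _ (abs_nonneg _)).2 fun z =>
      (hxu i z z.2).trans (le_abs_self _)
  obtain ⟨f, hf⟩ := hs
  have hfmem : f ∈ HoloSpace Ω :=
    (isClosed_holoSpace Ω).mem_of_tendsto hf (Eventually.of_forall fun s =>
      (HoloSpace Ω).sum_mem fun i _ => (x i).2)
  exact ⟨⟨f, hfmem⟩, (Topology.IsInducing.hasSum_iff (f := x) (g := (HoloSpace Ω).subtype)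
    Topology.IsInducing.subtypeVal ⟨f, hfmem⟩).1 hf⟩

theorem HoloSpace.exists_mem_dense_norm_sub_lt {D : Set (HoloSpace Ω)} (hD : Dense D)
    (f : HoloSpace Ω) {K : Set Ω} (hK : IsCompact K) {ε : ℝ} (hε : 0 < ε) :
    ∃ g ∈ D, ∀ z ∈ K, ‖g z - f z‖ < ε := by
  have hU : {g : HoloSpace Ω | Set.MapsTo (g.1 - f.1) K (Metric.ball 0 ε)} ∈ 𝓝 f := by
    have hcont : Continuous fun g : HoloSpace Ω => g.1 - f.1 :=
      continuous_subtype_val.sub continuous_const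
    exact ((ContinuousMap.isOpen_setOfPred_mapsTo hK Metric.isOpen_ball).preimage hcont).mem_nhds
      (fun z _ => by simpa using hε)
  obtain ⟨g, hg, hgD⟩ := mem_closure_iff_nhds.1 (hD f) _ hU
  exact ⟨g, hgD, fun z hz => by simpa using hg hz⟩

-- In the next three statements the group structure of `H(Ω)` has to be supplied by hand: unification
-- does not recover it from the additive monoid structure in the statements about `T`.

theorem SatisfiesFHC.isFrequentlyHypercyclic_holoSpace {T : HoloSpace Ω →L[ℂ] HoloSpace Ω}
    (hT : SatisfiesFHC T) : IsFrequentlyHypercyclic T :=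
  @SatisfiesFHC.isFrequentlyHypercyclic (HoloSpace Ω) (Submodule.addCommGroup _) _
    instUniformSpaceSubtype _ _ _ _ T hT

theorem SatisfiesFHC.isTopMixing_holoSpace {T : HoloSpace Ω →L[ℂ] HoloSpace Ω}
    (hT : SatisfiesFHC T) : IsTopMixing T :=
  @SatisfiesFHC.isTopMixing (HoloSpace Ω) (Submodule.addCommGroup _) _ _ _ T hT

theorem SatisfiesFHC.isChaotic_holoSpace {T : HoloSpace Ω →L[ℂ] HoloSpace Ω}
    (hT : SatisfiesFHC T) : IsChaotic T :=
  @SatisfiesFHC.isChaotic (HoloSpace Ω) (Submodule.addCommGroup _) _ instUniformSpaceSubtype _ _ _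
    T hT

end HoloSpace

/-! ### Laurent expansions on the punctured plane -/

section Laurent

theorem mem_puncturedPlane {z : ℂ} : z ∈ puncturedPlane ↔ z ≠ 0 := Iff.rfl

theorem puncturedPlane_ne_zero (z : puncturedPlane) : (z : ℂ) ≠ 0 := z.2

theorem exists_norm_bounds_of_isCompact {K : Set puncturedPlane} (hK : IsCompact K) :
    ∃ r R : ℝ, 0 < r ∧ 0 < R ∧ ∀ z ∈ K, r ≤ ‖(z : ℂ)‖ ∧ ‖(z : ℂ)‖ ≤ R := by
  have hcont : Continuous fun z : puncturedPlane => (z : ℂ) := continuous_subtype_val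
  obtain ⟨R, hR⟩ := hK.exists_bound_of_continuousOn hcont.continuousOn
  obtain ⟨R', hR'⟩ := hK.exists_bound_of_continuousOn
    (hcont.inv₀ puncturedPlane_ne_zero).continuousOn
  refine ⟨(max R' 1)⁻¹, max R 1, by positivity, by positivity, fun z hz => ⟨?_, ?_⟩⟩
  · have h := (hR' z hz).trans (le_max_left R' 1)
    have hpos : 0 < ‖(z : ℂ)‖ := norm_pos_iff.2 (puncturedPlane_ne_zero z)
    rw [Pi.inv_apply, norm_inv] at h
    exact inv_le_of_inv_le₀ hpos h
  · exact (hR z hz).trans (le_max_left R 1)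

theorem zpow_le_add_zpow {r R x : ℝ} (hr : 0 < r) (hrx : r ≤ x) (hxR : x ≤ R) (k : ℤ) :
    x ^ k ≤ r ^ k + R ^ k := by
  have hx : 0 < x := hr.trans_le hrx
  have hR : 0 < R := hx.trans_le hxR
  rcases le_total 0 k with hk | hk
  · have := zpow_le_zpow_left₀ hk hx.le hxR
    have := zpow_pos hr k
    linarith
  · have : x ^ k ≤ r ^ k := by
      rw [← neg_neg k, zpow_neg x, zpow_neg r]
      exact inv_anti₀ (zpow_pos hr _) (zpow_le_zpow_left₀ (by omega) hr.le hrx)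
    have := zpow_pos hR k
    linarith

/-- The circle average of a function on a rotated and dilated circle. -/
theorem circleAverage_comp_mul {E : Type*} [NormedAddCommGroup E] [NormedSpace ℝ E] (G : ℂ → E)
    (b : ℂ) (r : ℝ) :
    Real.circleAverage (fun z => G (b * z)) 0 r = Real.circleAverage G 0 (‖b‖ * r) := by
  rw [Real.circleAverage_eq_integral_add (f := G) b.arg, Real.circleAverage_def]
  congr 2
  ext θ
  congr 1
  conv_lhs => rw [← Complex.norm_mul_exp_arg_mul_I b]
  simp only [circleMap, zero_add]
  push_cast
  rw [add_mul, Complex.exp_add]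
  ring

theorem circleAverage_eq_of_differentiableOn {G : ℂ → ℂ} (hG : DifferentiableOn ℂ G {0}ᶜ)
    {r R : ℝ} (hr : 0 < r) (hR : 0 < R) :
    Real.circleAverage G 0 r = Real.circleAverage G 0 R := by
  wlog hrR : r ≤ R generalizing r R
  · exact (this hR hr (le_of_not_ge hrR)).symm
  rw [Real.circleAverage_eq_circleIntegral hr.ne', Real.circleAverage_eq_circleIntegral hR.ne',
    Complex.circleIntegral_sub_center_inv_smul_eq_of_differentiable_on_annulus_off_countable hr hrR
      Set.countable_empty]
  · refine hG.continuousOn.mono fun z hz => ?_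
    rintro rfl
    exact hz.2 (Metric.mem_ball_self hr)
  · intro z hz
    have hz0 : z ∈ ({0}ᶜ : Set ℂ) := by
      rintro rfl
      exact hz.1.2 (Metric.mem_closedBall_self hr.le)
    exact hG.differentiableAt (isOpen_compl_singleton.mem_nhds hz0)

/-- The `k`-th Laurent coefficient at the origin, as an average over the unit circle. -/
noncomputable def laurentCoeff (G : ℂ → ℂ) (k : ℤ) : ℂ :=
  Real.circleAverage (fun z => z ^ (-k) * G z) 0 1

theorem differentiableOn_zpow_mul {G : ℂ → ℂ} (hG : DifferentiableOn ℂ G {0}ᶜ) (k : ℤ) :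
    DifferentiableOn ℂ (fun z => z ^ k * G z) {0}ᶜ :=
  (differentiableOn_zpow k _ (Or.inl (by simp))).mul hG

theorem laurentCoeff_eq_circleAverage {G : ℂ → ℂ} (hG : DifferentiableOn ℂ G {0}ᶜ) (k : ℤ)
    {r : ℝ} (hr : 0 < r) :
    laurentCoeff G k = Real.circleAverage (fun z => z ^ (-k) * G z) 0 r :=
  circleAverage_eq_of_differentiableOn (differentiableOn_zpow_mul hG _) one_pos hr

theorem continuousOn_sphere {G : ℂ → ℂ} (hG : DifferentiableOn ℂ G {0}ᶜ) {r : ℝ} (hr : 0 < r) :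
    ContinuousOn G (Metric.sphere 0 r) :=
  hG.continuousOn.mono fun z hz => by
    rintro rfl
    simp [hr.ne] at hz

/-- Cauchy's estimates. -/
theorem norm_laurentCoeff_le {G : ℂ → ℂ} (hG : DifferentiableOn ℂ G {0}ᶜ) {r C : ℝ} (hr : 0 < r)
    (hC : ∀ z ∈ Metric.sphere (0 : ℂ) r, ‖G z‖ ≤ C) (k : ℤ) :
    ‖laurentCoeff G k‖ ≤ C * r ^ (-k) := by
  rw [laurentCoeff_eq_circleAverage hG k hr]
  have h : ∀ θ ∈ Set.uIoc 0 (2 * Real.pi),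
      ‖(circleMap 0 r θ) ^ (-k) * G (circleMap 0 r θ)‖ ≤ C * r ^ (-k) := by
    intro θ _
    rw [norm_mul, norm_zpow, norm_circleMap_zero, abs_of_pos hr, mul_comm]
    gcongr
    exact hC _ (circleMap_mem_sphere _ hr.le _)
  have := intervalIntegral.norm_integral_le_of_norm_le_const h
  rw [Real.circleAverage_def, norm_smul, norm_inv, Real.norm_of_nonneg Real.two_pi_pos.le,
    inv_mul_le_iff₀ Real.two_pi_pos]
  rw [sub_zero, abs_of_pos Real.two_pi_pos] at this
  linarith

theorem exists_norm_laurentCoeff_le {G : ℂ → ℂ} (hG : DifferentiableOn ℂ G {0}ᶜ) {r : ℝ}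
    (hr : 0 < r) : ∃ C : ℝ, ∀ k, ‖laurentCoeff G k‖ ≤ C * r ^ (-k) := by
  obtain ⟨C, hC⟩ := (isCompact_sphere (0 : ℂ) r).exists_bound_of_continuousOn
    (continuousOn_sphere hG hr)
  exact ⟨C, norm_laurentCoeff_le hG hr hC⟩

theorem summable_norm_laurentCoeff {G : ℂ → ℂ} (hG : DifferentiableOn ℂ G {0}ᶜ) {r : ℝ}
    (hr : 0 < r) : Summable fun k => ‖laurentCoeff G k‖ * r ^ k := by
  obtain ⟨C₁, hC₁⟩ := exists_norm_laurentCoeff_le hG (r := 2 * r) (by positivity)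
  obtain ⟨C₂, hC₂⟩ := exists_norm_laurentCoeff_le hG (r := r / 2) (by positivity)
  have hgeom (C : ℝ) : Summable fun n : ℕ => C * (1 / 2 : ℝ) ^ n := summable_geometric_two.mul_left C
  refine Summable.of_nat_of_neg ?_ ?_
  · refine (hgeom C₁).of_nonneg_of_le (fun n => by positivity) fun n => ?_
    calc ‖laurentCoeff G n‖ * r ^ (n : ℤ) ≤ C₁ * (2 * r) ^ (-(n : ℤ)) * r ^ (n : ℤ) := by
          gcongr
          exact hC₁ n
      _ = C₁ * (1 / 2 : ℝ) ^ n := by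
          rw [zpow_neg, zpow_natCast, zpow_natCast, mul_pow, one_div, inv_pow]
          field_simp
  · refine (hgeom C₂).of_nonneg_of_le (fun n => by positivity) fun n => ?_
    calc ‖laurentCoeff G (-n)‖ * r ^ (-(n : ℤ)) ≤ C₂ * (r / 2) ^ (-(-(n : ℤ))) * r ^ (-(n : ℤ)) := by
          gcongr
          exact hC₂ (-n)
      _ = C₂ * (1 / 2 : ℝ) ^ n := by
          rw [neg_neg, zpow_neg, zpow_natCast, zpow_natCast, div_pow, one_div, inv_pow]
          field_simp

/-- The Laurent series is the Fourier series on each circle; as its coefficients are summable it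
converges to the function. -/
theorem hasSum_laurentCoeff {G : ℂ → ℂ} (hG : DifferentiableOn ℂ G {0}ᶜ) {z : ℂ} (hz : z ≠ 0) :
    HasSum (fun k => laurentCoeff G k * z ^ k) (G z) := by
  have hT : Fact (0 < 2 * Real.pi) := ⟨Real.two_pi_pos⟩
  set r := ‖z‖ with hr
  have hr0 : 0 < r := norm_pos_iff.2 hz
  have hcont : Continuous fun x : AddCircle (2 * Real.pi) => G (r * (AddCircle.toCircle x : ℂ)) := by
    refine (continuousOn_sphere hG hr0).comp_continuous
      (continuous_const.mul (continuous_subtype_val.comp AddCircle.continuous_toCircle)) fun x => ?_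
    simp [abs_of_pos hr0, Circle.norm_coe]
  let g : C(AddCircle (2 * Real.pi), ℂ) := ⟨_, hcont⟩
  have hmap (x : ℝ) : (r : ℂ) * (AddCircle.toCircle (x : AddCircle (2 * Real.pi)) : ℂ) =
      circleMap 0 r x := by
    rw [AddCircle.toCircle_apply_mk, Circle.coe_exp, circleMap, zero_add]
    congr 3
    rw [div_self Real.two_pi_pos.ne', one_mul]
  have hfourier (k : ℤ) (x : ℝ) :
      (r : ℂ) ^ k * fourier k (x : AddCircle (2 * Real.pi)) = circleMap 0 r x ^ k := by
    rw [fourier_coe_apply, circleMap, zero_add, mul_zpow, ← Complex.exp_int_mul]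
    congr 2
    have : (Real.pi : ℂ) ≠ 0 := by exact_mod_cast Real.pi_ne_zero
    push_cast
    field_simp
  have hrk (k : ℤ) : (r : ℂ) ^ k ≠ 0 := zpow_ne_zero _ (by exact_mod_cast hr0.ne')
  have hcoeff (k : ℤ) : fourierCoeff g k = laurentCoeff G k * (r : ℂ) ^ k := by
    rw [fourierCoeff_eq_intervalIntegral _ _ 0, laurentCoeff_eq_circleAverage hG k hr0,
      Real.circleAverage_def, zero_add, one_div, smul_mul_assoc,
      ← intervalIntegral.integral_mul_const]
    congr 2
    ext x
    have h := hfourier (-k) x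
    have h' : fourier (-k) (x : AddCircle (2 * Real.pi)) = (r : ℂ) ^ k * circleMap 0 r x ^ (-k) := by
      rw [← h, ← mul_assoc, ← zpow_add₀ (by exact_mod_cast hr0.ne')]
      simp
    have hgx : g (x : AddCircle (2 * Real.pi)) = G (circleMap 0 r x) := by
      change G _ = _
      rw [hmap]
    rw [h', hgx, smul_eq_mul]
    ring
  have hsum : Summable (fourierCoeff g) := by
    refine Summable.of_norm ((summable_norm_laurentCoeff hG hr0).congr fun k => ?_)
    rw [hcoeff, norm_mul, norm_zpow, Complex.norm_real, Real.norm_of_nonneg hr0.le]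
  have h := has_pointwise_sum_fourier_series_of_summable hsum (z.arg : AddCircle (2 * Real.pi))
  have hzmap : circleMap 0 r z.arg = z := by
    rw [circleMap, zero_add, hr, Complex.norm_mul_exp_arg_mul_I]
  have hgz : g (z.arg : AddCircle (2 * Real.pi)) = G z := by
    change G _ = _
    rw [hmap, hzmap]
  rw [hgz] at h
  convert h using 2 with k
  rw [hcoeff, smul_eq_mul, mul_assoc, hfourier, hzmap]

/-- The function `z ↦ z ^ k` on the punctured plane. -/
noncomputable def laurentMonomial (k : ℤ) : HoloSpace puncturedPlane :=
  HoloSpace.mk (fun z => z ^ k) (differentiableOn_zpow k _ (Or.inl fun h => h rfl))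

@[simp] theorem laurentMonomial_apply (k : ℤ) (z : puncturedPlane) :
    laurentMonomial k z = (z : ℂ) ^ k := rfl

theorem summable_smul_laurentMonomial {a : ℤ → ℂ}
    (ha : ∀ r : ℝ, 0 < r → Summable fun k => ‖a k‖ * r ^ k) :
    Summable fun k => a k • laurentMonomial k := by
  refine HoloSpace.summable_of_norm_le fun K hK => ?_
  obtain ⟨r, R, hr, hR, h⟩ := exists_norm_bounds_of_isCompact hK
  refine ⟨fun k => ‖a k‖ * r ^ k + ‖a k‖ * R ^ k, (ha r hr).add (ha R hR), fun k z hz => ?_⟩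
  rw [HoloSpace.smul_apply, laurentMonomial_apply, norm_mul, norm_zpow]
  change _ ≤ ‖a k‖ * r ^ k + ‖a k‖ * R ^ k
  rw [← mul_add]
  gcongr
  exact zpow_le_add_zpow hr (h z hz).1 (h z hz).2 k

theorem HoloSpace.differentiableOn_zeroExtend (f : HoloSpace puncturedPlane) :
    DifferentiableOn ℂ (zeroExtend f) {0}ᶜ :=
  (HoloSpace.isHolo f).differentiableOn_zeroExtend

theorem HoloSpace.hasSum_laurent (f : HoloSpace puncturedPlane) :
    HasSum (fun k => laurentCoeff (zeroExtend f) k • laurentMonomial k) f := by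
  obtain ⟨g, hg⟩ := summable_smul_laurentMonomial fun r hr =>
    summable_norm_laurentCoeff (HoloSpace.differentiableOn_zeroExtend f) hr
  have : g = f := by
    ext z
    have h₁ := (HoloSpace.evalCLM z).hasSum hg
    have h₂ := hasSum_laurentCoeff (HoloSpace.differentiableOn_zeroExtend f) (puncturedPlane_ne_zero z)
    rw [zeroExtend_apply] at h₂
    exact h₁.unique h₂
  rw [this] at hg
  exact hg

theorem dense_span_laurentMonomial :
    Dense (Submodule.span ℂ (Set.range laurentMonomial) : Set (HoloSpace puncturedPlane)) := by
  intro f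
  refine mem_closure_of_tendsto (HoloSpace.hasSum_laurent f) (Eventually.of_forall fun s => ?_)
  exact Submodule.sum_mem _ fun k _ =>
    Submodule.smul_mem _ _ (Submodule.subset_span (Set.mem_range_self k))

end Laurent

/-! ### Zero-free functions and a cohomological equation on the punctured plane -/

section ZeroFree

theorem exists_exp_eq_of_forall_ne_zero {g : ℂ → ℂ} (hg : Differentiable ℂ g)
    (hg0 : ∀ s, g s ≠ 0) :
    ∃ h : ℂ → ℂ, (∀ s, HasDerivAt h (deriv g s / g s) s) ∧ ∀ s, Complex.exp (h s) = g s := by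
  have hdiff : Differentiable ℂ fun s => deriv g s / g s := fun s =>
    (hg.analyticAt s).deriv.differentiableAt.div (hg s) (hg0 s)
  obtain ⟨h, h0, hh⟩ := hdiff.isExactOn_univ.with_val_at 0 (Complex.log (g 0))
  have hh' : ∀ s, HasDerivAt h (deriv g s / g s) s := fun s => hh s trivial
  refine ⟨h, hh', fun s => ?_⟩
  have hderiv (s : ℂ) : HasDerivAt (fun s => g s * Complex.exp (-h s)) 0 s := by
    refine ((hg s).hasDerivAt.mul (hh' s).neg.cexp).congr_deriv ?_
    have := hg0 s
    simp only [Pi.neg_apply]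
    field_simp
    ring
  have hconst := is_const_of_deriv_eq_zero (fun s => (hderiv s).differentiableAt)
    (fun s => (hderiv s).deriv) s 0
  simp only [h0, Complex.exp_neg, Complex.exp_log (hg0 0), mul_inv_cancel₀ (hg0 0)] at hconst
  field_simp at hconst
  exact hconst.symm

/-- A zero-free holomorphic function on the punctured plane is a power of `z` times an
exponential: a logarithm of `G(e^{2πis})` changes by `2πim` under the translation by `1`. -/
theorem exists_zpow_mul_exp_eq {G : ℂ → ℂ} (hG : DifferentiableOn ℂ G {0}ᶜ)
    (hG0 : ∀ z, z ≠ 0 → G z ≠ 0) :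
    ∃ (m : ℤ) (W : ℂ → ℂ), DifferentiableOn ℂ W {0}ᶜ ∧
      ∀ z, z ≠ 0 → G z = z ^ m * Complex.exp (W z) := by
  let q : ℂ → ℂ := Function.Periodic.qParam 1
  have hq0 (s : ℂ) : q s ≠ 0 := Function.Periodic.qParam_ne_zero s
  have hqdiff : Differentiable ℂ q := by
    unfold q Function.Periodic.qParam
    fun_prop
  have hqper (s : ℂ) : q (s + 1) = q s := by
    simp only [q, Function.Periodic.qParam, Complex.ofReal_one, div_one, mul_add, mul_one,
      Complex.exp_add, Complex.exp_two_pi_mul_I]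
  have hg : Differentiable ℂ (G ∘ q) := fun s =>
    (hG.differentiableAt (isOpen_compl_singleton.mem_nhds (hq0 s))).comp s (hqdiff s)
  obtain ⟨h, hh, hexp⟩ := exists_exp_eq_of_forall_ne_zero hg fun s => hG0 _ (hq0 s)
  have hgper (s : ℂ) : (G ∘ q) (s + 1) = (G ∘ q) s := congrArg G (hqper s)
  have hderiv (s : ℂ) : HasDerivAt (fun s => h (s + 1) - h s) 0 s := by
    refine (((hh (s + 1)).comp_add_const s 1).sub (hh s)).congr_deriv ?_
    have : deriv (G ∘ q) (s + 1) = deriv (G ∘ q) s := by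
      rw [← deriv_comp_add_const (G ∘ q) 1 s]
      exact congrArg (fun F => deriv F s) (funext hgper)
    rw [this, hgper, sub_self]
  obtain ⟨m, hm⟩ : ∃ m : ℤ, h 1 = h 0 + m * (2 * Real.pi * Complex.I) := by
    refine Complex.exp_eq_exp_iff_exists_int.1 ?_
    rw [hexp, hexp]
    simpa using hgper 0
  have hstep (s : ℂ) : h (s + 1) = h s + m * (2 * Real.pi * Complex.I) := by
    have := is_const_of_deriv_eq_zero (fun s => (hderiv s).differentiableAt)
      (fun s => (hderiv s).deriv) s 0
    simp only [zero_add] at this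
    linear_combination this + hm
  let p : ℂ → ℂ := fun s => h s - m * (2 * Real.pi * Complex.I * s)
  have hp : Function.Periodic p ((1 : ℝ) : ℂ) := fun s => by
    simp only [p, Complex.ofReal_one, hstep]
    ring
  have hpdiff : Differentiable ℂ p := fun s => (hh s).differentiableAt.sub (by fun_prop)
  have hright {z : ℂ} (hz : z ≠ 0) : q (Function.Periodic.invQParam 1 z) = z :=
    Function.Periodic.qParam_right_inv one_ne_zero hz
  refine ⟨m, Function.Periodic.cuspFunction 1 p, fun z hz => ?_, fun z hz => ?_⟩
  · have := Function.Periodic.differentiableAt_cuspFunction one_ne_zero hp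
      (hpdiff (Function.Periodic.invQParam 1 z))
    change DifferentiableAt ℂ _ (q _) at this
    rw [hright hz] at this
    exact this.differentiableWithinAt
  · obtain ⟨s, rfl⟩ : ∃ s, q s = z := ⟨_, hright hz⟩
    have h₁ : Function.Periodic.cuspFunction 1 p (q s) = p s :=
      Function.Periodic.eq_cuspFunction one_ne_zero hp s
    rw [h₁, show G (q s) = Complex.exp (h s) from (hexp s).symm]
    simp only [q, Function.Periodic.qParam, p, Complex.ofReal_one, div_one]
    rw [← Complex.exp_int_mul, ← Complex.exp_add]
    congr 1
    ring

theorem abs_one_sub_le_abs_one_sub_pow {t : ℝ} (ht : 0 ≤ t) {n : ℕ} (hn : n ≠ 0) :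
    |1 - t| ≤ |1 - t ^ n| := by
  rw [← mul_neg_geom_sum, abs_mul]
  refine le_mul_of_one_le_right (abs_nonneg _) (le_trans ?_ (le_abs_self _))
  have h := Finset.single_le_sum (f := fun i => t ^ i) (fun i _ => pow_nonneg ht i)
    (Finset.mem_range.2 (Nat.pos_of_ne_zero hn))
  simpa using h

/-- There are no small divisors off the unit circle. -/
theorem exists_pos_le_norm_one_sub_zpow {b : ℂ} (hb1 : ‖b‖ ≠ 1) :
    ∃ δ > 0, ∀ k : ℤ, k ≠ 0 → δ ≤ ‖1 - b ^ k‖ := by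
  refine ⟨min |1 - ‖b‖| |1 - ‖b‖⁻¹|, lt_min ?_ ?_, fun k hk => ?_⟩
  · exact abs_pos.2 (sub_ne_zero.2 hb1.symm)
  · exact abs_pos.2 (sub_ne_zero.2 fun h => hb1 (inv_eq_one.1 h.symm))
  · have h : |1 - ‖b‖ ^ k| ≤ ‖1 - b ^ k‖ := by
      have := abs_norm_sub_norm_le (1 : ℂ) (b ^ k)
      rwa [norm_one, norm_zpow] at this
    refine le_trans ?_ h
    obtain ⟨n, rfl | rfl⟩ := k.eq_nat_or_neg
    · rw [zpow_natCast]
      exact (min_le_left _ _).trans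
        (abs_one_sub_le_abs_one_sub_pow (norm_nonneg b) (by simpa using hk))
    · rw [zpow_neg, zpow_natCast, ← inv_pow]
      exact (min_le_right _ _).trans
        (abs_one_sub_le_abs_one_sub_pow (inv_nonneg.2 (norm_nonneg b)) (by simpa using hk))

/-- The cohomological equation `V(z) - V(bz) = W(z) - w₀` for the dilation by `b`, with `w₀` the
constant Laurent coefficient of `W`, is solved coefficientwise. -/
theorem exists_sub_comp_mul_eq {W : ℂ → ℂ} (hW : DifferentiableOn ℂ W {0}ᶜ) {b : ℂ} (hb0 : b ≠ 0)
    (hb1 : ‖b‖ ≠ 1) :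
    ∃ V : ℂ → ℂ, DifferentiableOn ℂ V {0}ᶜ ∧
      ∀ z, z ≠ 0 → V z - V (b * z) = W z - laurentCoeff W 0 := by
  obtain ⟨δ, hδ, hδb⟩ := exists_pos_le_norm_one_sub_zpow hb1
  let a : ℤ → ℂ := fun k => if k = 0 then 0 else laurentCoeff W k / (1 - b ^ k)
  have ha (k : ℤ) : ‖a k‖ ≤ δ⁻¹ * ‖laurentCoeff W k‖ := by
    by_cases hk : k = 0
    · simp only [a, if_pos hk, norm_zero]
      positivity
    · simp only [a, if_neg hk, norm_div]
      rw [div_eq_inv_mul]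
      gcongr
      exact hδb k hk
  have hasum (r : ℝ) (hr : 0 < r) : Summable fun k => ‖a k‖ * r ^ k := by
    refine ((summable_norm_laurentCoeff hW hr).mul_left δ⁻¹).of_nonneg_of_le
      (fun k => by positivity) fun k => ?_
    rw [← mul_assoc]
    gcongr
    exact ha k
  obtain ⟨V, hV⟩ := summable_smul_laurentMonomial hasum
  have hVz (z : ℂ) (hz : z ≠ 0) : HasSum (fun k => a k * z ^ k) (zeroExtend V z) := by
    rw [zeroExtend_of_mem V (mem_puncturedPlane.2 hz)]
    exact (HoloSpace.evalCLM (⟨z, hz⟩ : puncturedPlane)).hasSum hV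
  refine ⟨zeroExtend V, HoloSpace.differentiableOn_zeroExtend V, fun z hz => ?_⟩
  have h₁ := (hVz z hz).sub (hVz (b * z) (mul_ne_zero hb0 hz))
  have h₂ := hasSum_ite_sub_hasSum (hasSum_laurentCoeff hW hz) 0
  rw [zpow_zero, mul_one] at h₂
  refine h₁.unique ?_
  convert h₂ using 2 with k
  by_cases hk : k = 0
  · simp [a, hk]
  · have : 1 - b ^ k ≠ 0 := fun h => by
      have := hδb k hk
      rw [h, norm_zero] at this
      linarith
    simp only [a, if_neg hk, mul_zpow]
    field_simp

theorem exists_exp_eq_mul_div_comp_mul {W : ℂ → ℂ} (hW : DifferentiableOn ℂ W {0}ᶜ) {b : ℂ}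
    (hb0 : b ≠ 0) (hb1 : ‖b‖ ≠ 1) :
    ∃ (c : ℂ) (E : ℂ → ℂ), c ≠ 0 ∧ DifferentiableOn ℂ E {0}ᶜ ∧ (∀ z, E z ≠ 0) ∧
      ∀ z, z ≠ 0 → Complex.exp (W z) = c * (E z / E (b * z)) := by
  obtain ⟨V, hV, h⟩ := exists_sub_comp_mul_eq hW hb0 hb1
  refine ⟨Complex.exp (laurentCoeff W 0), fun z => Complex.exp (V z), Complex.exp_ne_zero _,
    hV.cexp, fun z => Complex.exp_ne_zero _, fun z hz => ?_⟩
  rw [← Complex.exp_sub, ← Complex.exp_add]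
  congr 1
  linear_combination -h z hz

end ZeroFree

/-! ### Injective holomorphic self-maps of the punctured plane -/

section Injective

theorem analyticOnNhd_compl_zero {F : ℂ → ℂ} (hF : DifferentiableOn ℂ F {0}ᶜ) :
    AnalyticOnNhd ℂ F {0}ᶜ :=
  hF.analyticOnNhd isOpen_compl_singleton

theorem exists_ball_subset_image_of_injOn {F : ℂ → ℂ} (hF : DifferentiableOn ℂ F {0}ᶜ)
    (hinj : Set.InjOn F {0}ᶜ) {z₀ : ℂ} (hz₀ : z₀ ≠ 0) {U : Set ℂ} (hU : U ∈ 𝓝 z₀) :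
    ∃ ε > 0, Metric.ball (F z₀) ε ⊆ F '' U := by
  rcases (analyticOnNhd_compl_zero hF z₀ hz₀).eventually_constant_or_nhds_le_map_nhds with h | h
  · exfalso
    have h₁ : ∀ᶠ z in 𝓝[≠] z₀, F z = F z₀ ∧ z ∈ ({0}ᶜ : Set ℂ) ∧ z ≠ z₀ := by
      have h₂ := (h.and (isOpen_compl_singleton.mem_nhds hz₀)).filter_mono
        (nhdsWithin_le_nhds (s := {z₀}ᶜ))
      filter_upwards [h₂, self_mem_nhdsWithin] with z hz hne
      exact ⟨hz.1, hz.2, hne⟩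
    obtain ⟨z, hz, hz0, hne⟩ := h₁.exists
    exact hne (hinj hz0 hz₀ hz)
  · exact Metric.mem_nhds_iff.1 (h (image_mem_map hU))

/-- The part of the Casorati–Weierstrass theorem that is needed: a function that omits a disc near
an isolated singularity at the origin is meromorphic there. -/
theorem meromorphicAt_zero_of_omits_ball {F : ℂ → ℂ} (hF : DifferentiableOn ℂ F {0}ᶜ) {w : ℂ}
    {ε : ℝ} (hε : 0 < ε) (h : ∀ᶠ z in 𝓝[≠] (0 : ℂ), ε ≤ ‖F z - w‖) : MeromorphicAt F 0 := by
  have hd : ∀ᶠ z in 𝓝[≠] (0 : ℂ), DifferentiableAt ℂ (fun z => (F z - w)⁻¹) z := by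
    filter_upwards [h, self_mem_nhdsWithin] with z hz hz0
    refine ((hF.differentiableAt (isOpen_compl_singleton.mem_nhds hz0)).sub_const w).inv ?_
    exact norm_pos_iff.1 (hε.trans_le hz)
  have hb : IsBoundedUnder (· ≤ ·) (𝓝[≠] (0 : ℂ))
      fun z => ‖(F z - w)⁻¹ - (F 0 - w)⁻¹‖ := by
    refine ⟨ε⁻¹ + ‖(F 0 - w)⁻¹‖, ?_⟩
    rw [eventually_map]
    filter_upwards [h] with z hz
    refine (norm_sub_le _ _).trans ?_
    rw [norm_inv]
    gcongr
  have hlim := Complex.tendsto_limUnder_of_differentiable_on_punctured_nhds_of_bounded_under hd hb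
  set L := limUnder (𝓝[≠] (0 : ℂ)) fun z => (F z - w)⁻¹
  have hana : AnalyticAt ℂ (Function.update (fun z => (F z - w)⁻¹) 0 L) 0 := by
    refine Complex.analyticAt_of_differentiable_on_punctured_nhds_of_continuousAt ?_
      (continuousAt_update_same.2 hlim)
    filter_upwards [hd, self_mem_nhdsWithin] with z hz hz0
    refine hz.congr_of_eventuallyEq ?_
    filter_upwards [isOpen_compl_singleton.mem_nhds hz0] with y hy
    exact Function.update_of_ne hy _ _
  have hmer := hana.meromorphicAt.inv.add (MeromorphicAt.const w 0)
  refine hmer.congr ?_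
  filter_upwards [self_mem_nhdsWithin] with z hz
  simp [Function.update_of_ne (Set.mem_compl_singleton_iff.1 hz)]

/-- Near the origin, a zero-free function with a meromorphic singularity is a power of `z` times a
function with a non-zero limit. -/
theorem exists_zpow_tendsto {F : ℂ → ℂ} (hF : MeromorphicAt F 0) (hF0 : ∀ z, z ≠ 0 → F z ≠ 0) :
    ∃ (k : ℤ) (g : ℂ → ℂ), AnalyticAt ℂ g 0 ∧ g 0 ≠ 0 ∧
      ∀ᶠ z in 𝓝[≠] (0 : ℂ), F z = z ^ k * g z := by
  have htop : meromorphicOrderAt F 0 ≠ ⊤ := by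
    rw [meromorphicOrderAt_ne_top_iff_eventually_ne_zero hF]
    filter_upwards [self_mem_nhdsWithin] with z hz using hF0 z hz
  obtain ⟨g, hg, hg0, h⟩ := (meromorphicOrderAt_ne_top_iff hF).1 htop
  refine ⟨(meromorphicOrderAt F 0).untop₀, g, hg, hg0, ?_⟩
  filter_upwards [h] with z hz
  simpa using hz

theorem exists_eq_const_mul_zpow {F : ℂ → ℂ} (hF : DifferentiableOn ℂ F {0}ᶜ)
    (hF0 : ∀ z, z ≠ 0 → F z ≠ 0) (h0 : MeromorphicAt F 0)
    (hinf : MeromorphicAt (fun z => F z⁻¹) 0) :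
    ∃ (c : ℂ) (k : ℤ), c ≠ 0 ∧ ∀ z, z ≠ 0 → F z = c * z ^ k := by
  obtain ⟨k, g, hg, hg0, hFg⟩ := exists_zpow_tendsto h0 hF0
  let G : ℂ → ℂ := Function.update (fun z => z ^ (-k) * F z) 0 (g 0)
  have hGne (z : ℂ) (hz : z ≠ 0) : G z = z ^ (-k) * F z := Function.update_of_ne hz _ _
  have hG0 (z : ℂ) : G z ≠ 0 := by
    by_cases hz : z = 0
    · simpa [G, hz] using hg0
    · rw [hGne z hz]
      exact mul_ne_zero (zpow_ne_zero _ hz) (hF0 z hz)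
  have hGdiff : Differentiable ℂ G := by
    intro z
    by_cases hz : z = 0
    · rw [hz]
      refine hg.differentiableAt.congr_of_eventuallyEq ?_
      rw [eventually_nhdsWithin_iff] at hFg
      filter_upwards [hFg] with y hy
      by_cases hy0 : y = 0
      · simp [G, hy0]
      · rw [hGne y hy0, hy hy0, ← mul_assoc, ← zpow_add₀ hy0]
        simp
    · have h₁ := (differentiableOn_zpow_mul hF (-k)).differentiableAt
        (isOpen_compl_singleton.mem_nhds hz)
      refine h₁.congr_of_eventuallyEq ?_
      filter_upwards [isOpen_compl_singleton.mem_nhds hz] with y hy using hGne y hy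
  have hGinf : MeromorphicAt (fun z => G z⁻¹) 0 := by
    have h₁ : MeromorphicAt (fun z : ℂ => z ^ k * F z⁻¹) 0 :=
      ((MeromorphicAt.id 0).zpow k).mul hinf
    refine h₁.congr ?_
    filter_upwards [self_mem_nhdsWithin] with z hz
    rw [hGne _ (inv_ne_zero hz), inv_zpow, zpow_neg, inv_inv]
  obtain ⟨l, u, hu, hu0, hGu⟩ := exists_zpow_tendsto hGinf fun z _ => hG0 _
  have hinv : Tendsto (fun z : ℂ => z⁻¹) (cocompact ℂ) (𝓝[≠] 0) := by
    rw [← Metric.cobounded_eq_cocompact]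
    exact tendsto_inv₀_cobounded'
  have htends {H : ℂ → ℂ} {n : ℕ} {v : ℂ → ℂ} (hv : ContinuousAt v 0)
      (hH : ∀ᶠ z in 𝓝[≠] (0 : ℂ), H z⁻¹ = z ^ n * v z) :
      Tendsto H (cocompact ℂ) (𝓝 (0 ^ n * v 0)) := by
    have h₁ : Tendsto (fun z : ℂ => z ^ n * v z) (𝓝[≠] 0) (𝓝 (0 ^ n * v 0)) :=
      (((continuous_pow n).continuousAt.mul hv).tendsto).mono_left nhdsWithin_le_nhds
    refine ((h₁.congr' (hH.mono fun z hz => hz.symm)).comp hinv).congr fun z => ?_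
    simp
  -- By Liouville's theorem `G` is constant: either `G` or `1 / G` has a limit at infinity.
  obtain ⟨c, hc⟩ : ∃ c, ∀ z, G z = c := by
    obtain ⟨n, rfl | rfl⟩ := l.eq_nat_or_neg
    · refine ⟨_, fun z => hGdiff.apply_eq_of_tendsto_cocompact z
        (htends (n := n) hu.continuousAt ?_)⟩
      filter_upwards [hGu] with z hz
      rw [hz, zpow_natCast]
    · have h₁ : ∀ z, (G z)⁻¹ = _ := fun z =>
        (hGdiff.inv hG0).apply_eq_of_tendsto_cocompact z
          (htends (n := n) (hu.continuousAt.inv₀ hu0) (by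
            filter_upwards [hGu] with z hz
            simp [hz, mul_comm]))
      exact ⟨_, fun z => by rw [← inv_inv (G z), h₁]⟩
  refine ⟨c, k, fun h => hG0 0 ((hc 0).trans h), fun z hz => ?_⟩
  rw [← hc z, hGne z hz, mul_right_comm, ← zpow_add₀ hz]
  simp

theorem eq_one_or_neg_one_of_injOn_zpow {k : ℤ} (hk : Set.InjOn (fun z : ℂ => z ^ k) {0}ᶜ) :
    k = 1 ∨ k = -1 := by
  have hk0 : k ≠ 0 := by
    rintro rfl
    have h : (1 : ℂ) = 2 := hk (by simp) (by simp) (by simp)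
    norm_num at h
  have hn : k.natAbs ≠ 0 := Int.natAbs_ne_zero.2 hk0
  have hprim := Complex.isPrimitiveRoot_exp k.natAbs hn
  set ζ := Complex.exp (2 * Real.pi * Complex.I / (k.natAbs : ℂ))
  have hζ : ζ ^ k = 1 := (hprim.zpow_eq_one_iff_dvd k).2 (by simp)
  have h1 : ζ = 1 := hk (Complex.exp_ne_zero _) (by simp) (hζ.trans (one_zpow k).symm)
  have : k.natAbs = 1 := by
    have := hprim.eq_orderOf
    rwa [h1, orderOf_one] at this
  omega

/-- The injective holomorphic self-maps of the punctured plane are `z ↦ bz` and `z ↦ b/z`. By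
injectivity the map omits near `0` a disc of values taken away from `0`, and likewise near `∞`, so
neither singularity is essential. -/
theorem eq_mul_or_eq_div_of_injOn {F : ℂ → ℂ} (hF : DifferentiableOn ℂ F {0}ᶜ)
    (hF0 : ∀ z, z ≠ 0 → F z ≠ 0) (hinj : Set.InjOn F {0}ᶜ) :
    ∃ b : ℂ, b ≠ 0 ∧ ((∀ z, z ≠ 0 → F z = b * z) ∨ ∀ z, z ≠ 0 → F z = b / z) := by
  have h0 : MeromorphicAt F 0 := by
    obtain ⟨ε, hε, hball⟩ := exists_ball_subset_image_of_injOn hF hinj (two_ne_zero (α := ℂ))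
      (Metric.ball_mem_nhds (2 : ℂ) one_pos)
    refine meromorphicAt_zero_of_omits_ball hF (w := F 2) hε ?_
    have h1 : Metric.ball (0 : ℂ) 1 ∈ 𝓝[≠] (0 : ℂ) :=
      mem_nhdsWithin_of_mem_nhds (Metric.ball_mem_nhds 0 one_pos)
    filter_upwards [h1, self_mem_nhdsWithin] with z hz hz0
    by_contra! hlt
    obtain ⟨y, hy, hyz⟩ := hball (mem_ball_iff_norm.2 hlt)
    have hy1 : 1 < ‖y‖ := by
      have h₁ := mem_ball_iff_norm'.1 hy
      have h₂ := norm_le_norm_add_norm_sub' (2 : ℂ) y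
      rw [Complex.norm_ofNat] at h₂
      linarith
    have hy0 : y ≠ 0 := norm_pos_iff.1 (one_pos.trans hy1)
    rw [hinj hy0 hz0 hyz] at hy1
    have := mem_ball_zero_iff.1 hz
    linarith
  have hinvdiff : DifferentiableOn ℂ (fun z => F z⁻¹) {0}ᶜ :=
    hF.comp (differentiableOn_inv.mono fun z hz => hz) fun z hz => inv_ne_zero hz
  have hinf : MeromorphicAt (fun z => F z⁻¹) 0 := by
    have hhalf : (1 / 2 : ℂ) ≠ 0 := by norm_num
    obtain ⟨ε, hε, hball⟩ := exists_ball_subset_image_of_injOn hF hinj hhalf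
      (Metric.ball_mem_nhds (1 / 2 : ℂ) (half_pos one_pos))
    refine meromorphicAt_zero_of_omits_ball hinvdiff (w := F (1 / 2)) hε ?_
    have h1 : Metric.ball (0 : ℂ) 1 ∈ 𝓝[≠] (0 : ℂ) :=
      mem_nhdsWithin_of_mem_nhds (Metric.ball_mem_nhds 0 one_pos)
    filter_upwards [h1, self_mem_nhdsWithin] with z hz hz0
    by_contra! hlt
    obtain ⟨y, hy, hyz⟩ := hball (mem_ball_iff_norm.2 hlt)
    have hy1 : ‖y‖ < 1 := by
      have h₁ := mem_ball_iff_norm.1 hy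
      have h₂ := norm_le_norm_add_norm_sub' y (1 / 2 : ℂ)
      have h₃ : ‖(1 / 2 : ℂ)‖ = 1 / 2 := by norm_num
      rw [h₃] at h₂
      linarith
    have hy0 : y ≠ 0 := by
      rintro rfl
      have := mem_ball_iff_norm.1 hy
      norm_num at this
    rw [hinj hy0 (inv_ne_zero hz0) hyz, norm_inv] at hy1
    have h₂ := mem_ball_zero_iff.1 hz
    have h₃ : 1 < ‖z‖⁻¹ := (one_lt_inv₀ (norm_pos_iff.2 hz0)).2 h₂
    linarith
  obtain ⟨c, k, hc, hck⟩ := exists_eq_const_mul_zpow hF hF0 h0 hinf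
  have hk : Set.InjOn (fun z : ℂ => z ^ k) {0}ᶜ := fun z hz y hy h => by
    refine hinj hz hy ?_
    rw [hck z hz, hck y hy]
    exact congrArg (c * ·) h
  refine ⟨c, hc, ?_⟩
  rcases eq_one_or_neg_one_of_injOn_zpow hk with rfl | rfl
  · exact Or.inl fun z hz => by simpa using hck z hz
  · exact Or.inr fun z hz => by simpa [div_eq_mul_inv] using hck z hz

end Injective

/-! ### The criterion for weighted dilations -/

section Dilation

/-- The function `z ↦ z ^ k E(z)` on the punctured plane. -/
noncomputable def weightedMonomial (E : ℂ → ℂ) (hE : DifferentiableOn ℂ E {0}ᶜ) (k : ℤ) :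
    HoloSpace puncturedPlane :=
  HoloSpace.mk (fun z => z ^ k * E z) (differentiableOn_zpow_mul hE k)

@[simp] theorem weightedMonomial_apply (E : ℂ → ℂ) (hE : DifferentiableOn ℂ E {0}ᶜ) (k : ℤ)
    (z : puncturedPlane) : weightedMonomial E hE k z = (z : ℂ) ^ k * E z := rfl

theorem dense_span_weightedMonomial {E : ℂ → ℂ} (hE : DifferentiableOn ℂ E {0}ᶜ)
    (hE0 : ∀ z, E z ≠ 0) :
    Dense (Submodule.span ℂ (Set.range (weightedMonomial E hE)) :
      Set (HoloSpace puncturedPlane)) := by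
  have hid : IsHolo puncturedPlane fun z => ((id z : puncturedPlane) : ℂ) :=
    ⟨id, differentiableOn_id, fun _ => rfl⟩
  let M := weightedComp (fun z : puncturedPlane => E z) ⟨E, hE, fun _ => rfl⟩ id hid
  have hsurj : Function.Surjective M := by
    intro f
    refine ⟨HoloSpace.mk (fun z => zeroExtend f z / E z)
      ((HoloSpace.differentiableOn_zeroExtend f).div hE fun z _ => hE0 z), ?_⟩
    ext z
    change E z * (zeroExtend f z / E z) = f z
    rw [zeroExtend_apply, mul_div_cancel₀ _ (hE0 z)]
  have h := hsurj.denseRange.dense_image M.continuous dense_span_laurentMonomial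
  have himage : M '' (Submodule.span ℂ (Set.range laurentMonomial) : Set _) =
      (Submodule.span ℂ (Set.range (weightedMonomial E hE)) : Set _) := by
    have := Submodule.map_span (M : HoloSpace puncturedPlane →ₗ[ℂ] HoloSpace puncturedPlane)
      (Set.range laurentMonomial)
    rw [← Set.range_comp] at this
    have hcomp : (M : HoloSpace puncturedPlane →ₗ[ℂ] HoloSpace puncturedPlane) ∘ laurentMonomial =
        weightedMonomial E hE := by
      funext k
      ext z
      exact mul_comm _ _
    rw [hcomp] at this
    rw [← this]
    rfl
  rwa [himage] at h

variable {E : ℂ → ℂ} {hE : DifferentiableOn ℂ E {0}ᶜ}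
  {T : HoloSpace puncturedPlane →L[ℂ] HoloSpace puncturedPlane} {c b : ℂ} {m : ℤ}

theorem iterate_weightedMonomial
    (hT : ∀ k, T (weightedMonomial E hE k) = (c * b ^ k) • weightedMonomial E hE (k + m))
    (k : ℤ) (n : ℕ) :
    T^[n] (weightedMonomial E hE k) =
      (∏ i ∈ Finset.range n, c * b ^ (k + i * m)) • weightedMonomial E hE (k + n * m) := by
  induction n with
  | zero => simp
  | succ n ih =>
    rw [Function.iterate_succ_apply', ih, map_smul, hT, smul_smul, Finset.prod_range_succ]
    congr 2
    push_cast
    ring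

/-- The coefficients `∏_{i < n} c b^{k + im}` decay like `|b|^{m n² / 2}`. -/
theorem summable_prod_norm_mul_zpow (hc : c ≠ 0) (hb : b ≠ 0) (hbm : ‖b‖ ^ m < 1) (k : ℤ) {r : ℝ}
    (hr : 0 < r) :
    Summable fun n : ℕ => ‖∏ i ∈ Finset.range n, c * b ^ (k + i * m)‖ * r ^ (k + n * m) := by
  have hpos (n : ℕ) : 0 < ‖∏ i ∈ Finset.range n, c * b ^ (k + i * m)‖ * r ^ (k + n * m) := by
    refine mul_pos (norm_pos_iff.2 ?_) (zpow_pos hr _)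
    exact Finset.prod_ne_zero_iff.2 fun i _ => mul_ne_zero hc (zpow_ne_zero _ hb)
  refine summable_of_ratio_test_tendsto_lt_one zero_lt_one
    (Eventually.of_forall fun n => (hpos n).ne') ?_
  have hlim : Tendsto (fun n : ℕ => ‖c‖ * ‖b‖ ^ k * r ^ m * (‖b‖ ^ m) ^ n) atTop (𝓝 0) := by
    simpa using (tendsto_pow_atTop_nhds_zero_of_lt_one (zpow_nonneg (norm_nonneg b) m)
      hbm).const_mul (‖c‖ * ‖b‖ ^ k * r ^ m)
  refine hlim.congr fun n => ?_
  rw [Real.norm_of_nonneg (hpos _).le, Real.norm_of_nonneg (hpos _).le, eq_div_iff (hpos n).ne',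
    Finset.prod_range_succ, norm_mul, norm_mul c, norm_zpow]
  have h₁ : r ^ (k + ((n + 1 : ℕ) : ℤ) * m) = r ^ (k + n * m) * r ^ m := by
    rw [← zpow_add₀ hr.ne']
    congr 1
    push_cast
    ring
  have h₂ : ‖b‖ ^ (k + (n : ℤ) * m) = ‖b‖ ^ k * (‖b‖ ^ m) ^ n := by
    rw [zpow_add₀ (norm_ne_zero_iff.2 hb), mul_comm (n : ℤ) m, zpow_mul, zpow_natCast]
  rw [h₁, h₂]
  ring

theorem summable_iterate_of_mem_span
    (hT : ∀ k, T (weightedMonomial E hE k) = (c * b ^ k) • weightedMonomial E hE (k + m))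
    (hc : c ≠ 0) (hb : b ≠ 0) (hbm : ‖b‖ ^ m < 1) {f : HoloSpace puncturedPlane}
    (hf : f ∈ Submodule.span ℂ (Set.range (weightedMonomial E hE))) :
    Summable fun n => T^[n] f := by
  induction hf using Submodule.span_induction with
  | mem f hf =>
    obtain ⟨k, rfl⟩ := hf
    refine HoloSpace.summable_of_norm_le fun K hK => ?_
    obtain ⟨r, R, hr, hR, h⟩ := exists_norm_bounds_of_isCompact hK
    obtain ⟨M, hM⟩ := hK.exists_bound_of_continuousOn
      (IsHolo.continuous (⟨E, hE, fun _ => rfl⟩ :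
        IsHolo puncturedPlane fun z => E z)).continuousOn
    refine ⟨_, ((summable_prod_norm_mul_zpow hc hb hbm k hr).add
      (summable_prod_norm_mul_zpow hc hb hbm k hR)).mul_right M, fun n z hz => ?_⟩
    rw [iterate_weightedMonomial hT, HoloSpace.smul_apply, weightedMonomial_apply, norm_mul,
      norm_mul, norm_zpow, ← mul_assoc, ← mul_add]
    refine mul_le_mul (mul_le_mul_of_nonneg_left ?_ (norm_nonneg _)) (hM z hz) (norm_nonneg _)
      (mul_nonneg (norm_nonneg _) (add_nonneg (zpow_pos hr _).le (zpow_pos hR _).le))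
    exact zpow_le_add_zpow hr (h z hz).1 (h z hz).2 _
  | zero =>
    simp only [← FunLike.coe_pow_eq_iterate, map_zero]
    exact summable_zero
  | add f g _ _ hf hg =>
    simpa only [← FunLike.coe_pow_eq_iterate, map_add] using hf.add hg
  | smul a f _ hf =>
    simpa only [← FunLike.coe_pow_eq_iterate, map_smul] using hf.const_smul a

theorem mapsTo_span_weightedMonomial
    (hT : ∀ k, T (weightedMonomial E hE k) = (c * b ^ k) • weightedMonomial E hE (k + m)) :
    Set.MapsTo T (Submodule.span ℂ (Set.range (weightedMonomial E hE)))
      (Submodule.span ℂ (Set.range (weightedMonomial E hE))) := by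
  intro f hf
  refine (Submodule.span_le (p := (Submodule.span ℂ (Set.range (weightedMonomial E hE))).comap
    (T : HoloSpace puncturedPlane →ₗ[ℂ] HoloSpace puncturedPlane))).2 ?_ hf
  rintro _ ⟨k, rfl⟩
  change T _ ∈ Submodule.span ℂ (Set.range (weightedMonomial E hE))
  rw [hT]
  exact Submodule.smul_mem _ _ (Submodule.subset_span (Set.mem_range_self _))

theorem weightedComp_weightedMonomial {ω : puncturedPlane → ℂ} (hω : IsHolo puncturedPlane ω)
    {ψ : puncturedPlane → puncturedPlane} (hψ : IsHolo puncturedPlane (fun z => (ψ z : ℂ)))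
    (hE0 : ∀ z, E z ≠ 0)
    (hωE : ∀ z : puncturedPlane, ω z = (z : ℂ) ^ m * (c * (E z / E (b * z))))
    (hψb : ∀ z : puncturedPlane, (ψ z : ℂ) = b * z) (k : ℤ) :
    weightedComp ω hω ψ hψ (weightedMonomial E hE k) =
      (c * b ^ k) • weightedMonomial E hE (k + m) := by
  ext z
  have h₁ := hE0 (b * z)
  rw [weightedComp_apply, HoloSpace.smul_apply, weightedMonomial_apply, weightedMonomial_apply,
    hωE, hψb, mul_zpow, zpow_add₀ (puncturedPlane_ne_zero z)]
  field_simp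

/-- If `ω(z) = c z ^ m E(z) / E(bz)` with `|b| ^ m < 1`, the functions `z ^ k E(z)` are multiplied
by rapidly decreasing weights both by the powers of the weighted dilation and by those of its
inverse, which is a weighted dilation of the same kind. -/
theorem satisfiesFHC_weightedComp {ω : puncturedPlane → ℂ} (hω : IsHolo puncturedPlane ω)
    {ψ : puncturedPlane → puncturedPlane} (hψ : IsHolo puncturedPlane (fun z => (ψ z : ℂ)))
    (hE : DifferentiableOn ℂ E {0}ᶜ) (hE0 : ∀ z, E z ≠ 0) (hc : c ≠ 0) (hb : b ≠ 0)
    (hbm : ‖b‖ ^ m < 1)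
    (hωE : ∀ z : puncturedPlane, ω z = (z : ℂ) ^ m * (c * (E z / E (b * z))))
    (hψb : ∀ z : puncturedPlane, (ψ z : ℂ) = b * z) :
    SatisfiesFHC (weightedComp ω hω ψ hψ) := by
  let ω' : puncturedPlane → ℂ := fun z =>
    (z : ℂ) ^ (-m) * (c⁻¹ * b ^ m * (E z / E (b⁻¹ * z)))
  have hω' : IsHolo puncturedPlane ω' := by
    refine ⟨fun z => z ^ (-m) * (c⁻¹ * b ^ m * (E z / E (b⁻¹ * z))), ?_, fun _ => rfl⟩
    have hEb : DifferentiableOn ℂ (fun z => E (b⁻¹ * z)) {0}ᶜ :=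
      hE.comp (differentiableOn_id.const_mul _) fun z hz => mul_ne_zero (inv_ne_zero hb) hz
    exact differentiableOn_zpow_mul ((hE.div hEb fun z _ => hE0 _).const_mul _) _
  let ψ' : puncturedPlane → puncturedPlane := fun z =>
    ⟨b⁻¹ * z, mul_ne_zero (inv_ne_zero hb) (puncturedPlane_ne_zero z)⟩
  have hψ' : IsHolo puncturedPlane fun z => (ψ' z : ℂ) :=
    ⟨fun z => b⁻¹ * z, differentiableOn_id.const_mul _, fun _ => rfl⟩
  set T := weightedComp ω hω ψ hψ with hTdef
  let T' := weightedComp ω' hω' ψ' hψ'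
  have hT := weightedComp_weightedMonomial (hE := hE) hω hψ hE0 hωE hψb
  have hT' := weightedComp_weightedMonomial (hE := hE) hω' hψ' hE0 (fun _ => rfl) (fun _ => rfl)
  have hTT' (f : HoloSpace puncturedPlane) : T (T' f) = f := by
    ext z
    have h₁ : ψ' (ψ z) = z := by
      apply Subtype.ext
      simp only [ψ', hψb, inv_mul_cancel_left₀ hb]
    have h₂ : ω z * ω' (ψ z) = 1 := by
      have := hE0 z
      have := hE0 (b * z)
      have := zpow_ne_zero m hb
      have := zpow_ne_zero m (puncturedPlane_ne_zero z)
      simp only [ω', hωE, hψb, inv_mul_cancel_left₀ hb, mul_zpow, zpow_neg]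
      field_simp
    rw [hTdef, weightedComp_apply, weightedComp_apply, h₁, ← mul_assoc, h₂, one_mul]
  let X₀ := Submodule.span ℂ (Set.range (weightedMonomial E hE))
  let S : X₀ → X₀ := fun f => ⟨T' f, mapsTo_span_weightedMonomial hT' f.2⟩
  have hS (n : ℕ) (f : X₀) : ((S^[n] f : X₀) : HoloSpace puncturedPlane) = T'^[n] f := by
    induction n with
    | zero => rfl
    | succ n ih => rw [Function.iterate_succ_apply', Function.iterate_succ_apply', ← ih]
  refine ⟨X₀, dense_span_weightedMonomial hE hE0, S, fun f => ⟨?_, ?_, hTT' f⟩⟩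
  · exact (summable_nat_add_iff (f := fun n => T^[n] (f : HoloSpace puncturedPlane)) 1).2
      (summable_iterate_of_mem_span hT hc hb hbm f.2)
  · have hc' : c⁻¹ * b ^ m ≠ 0 := mul_ne_zero (inv_ne_zero hc) (zpow_ne_zero _ hb)
    have hbm' : ‖b⁻¹‖ ^ (-m) < 1 := by rwa [norm_inv, inv_zpow, zpow_neg, inv_inv]
    have h := (summable_nat_add_iff
      (f := fun n => T'^[n] (f : HoloSpace puncturedPlane)) 1).2
      (summable_iterate_of_mem_span hT' hc' (inv_ne_zero hb) hbm' f.2)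
    exact h.congr fun n => (hS (n + 1) f).symm

end Dilation

/-! ### Obstructions to supercyclicity -/

section Obstructions

/-- In dimension at least two, a supercyclic operator has dense range. -/
theorem IsSupercyclic.eq_zero_of_comp_eq_zero {X : Type*} [AddCommMonoid X] [Module ℂ X]
    [TopologicalSpace X] {T : X →L[ℂ] X} (hT : IsSupercyclic T) {φ : X →L[ℂ] ℂ}
    (hφ : ∀ f, φ (T f) = 0) {χ₁ χ₂ : X →L[ℂ] ℂ}
    (hχ : ∀ s t : ℂ, ∃ f, χ₁ f = s ∧ χ₂ f = t) (g : X) : φ g = 0 := by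
  by_contra hg
  obtain ⟨f, hf⟩ := hT
  -- A non-zero functional that vanishes at `f`.
  obtain ⟨χ, hχf, u, hu⟩ : ∃ χ : X →L[ℂ] ℂ, χ f = 0 ∧ ∃ u, χ u ≠ 0 := by
    by_cases h : χ₁ f = 0
    · obtain ⟨u, hu, -⟩ := hχ 1 0
      exact ⟨χ₁, h, u, by simp [hu]⟩
    · obtain ⟨u, hu₁, hu₂⟩ := hχ 0 1
      refine ⟨χ₁ f • χ₂ + (-χ₂ f) • χ₁, ?_, u, ?_⟩
      · simp [mul_comm]
      · simpa [hu₁, hu₂] using h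
  obtain ⟨v, hv₁, hv₂⟩ : ∃ v, φ v ≠ 0 ∧ χ v ≠ 0 := by
    by_cases h₁ : χ g = 0
    · by_cases h₂ : φ u = 0
      · exact ⟨g + u, by simpa [h₂] using hg, by simpa [h₁] using hu⟩
      · exact ⟨u, h₂, hu⟩
    · exact ⟨g, hg, h₁⟩
  have hopen : IsOpen {v | φ v ≠ 0 ∧ χ v ≠ 0} :=
    (isOpen_ne_fun φ.continuous continuous_const).inter
      (isOpen_ne_fun χ.continuous continuous_const)
  obtain ⟨_, ⟨hx₁, hx₂⟩, c, n, rfl⟩ := hf.inter_open_nonempty _ hopen ⟨v, hv₁, hv₂⟩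
  cases n with
  | zero => exact hx₂ (by simp [hχf])
  | succ n => exact hx₁ (by rw [map_smul, Function.iterate_succ_apply', hφ, smul_zero])

variable {Ω : Opens ℂ}

theorem exists_apply_eq_and_apply_eq {z₁ z₂ : Ω} (hz : z₁ ≠ z₂) (s t : ℂ) :
    ∃ f : HoloSpace Ω, HoloSpace.evalCLM z₁ f = s ∧ HoloSpace.evalCLM z₂ f = t := by
  have h : (z₁ : ℂ) - z₂ ≠ 0 := sub_ne_zero.2 fun h => hz (Subtype.ext h)
  refine ⟨HoloSpace.mk (fun z => t + (s - t) / (z₁ - z₂) * (z - z₂))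
    (((differentiableOn_id.sub_const _).const_mul _).const_add _), ?_, ?_⟩
  · simp only [HoloSpace.evalCLM_apply, HoloSpace.mk_apply]
    field_simp
    ring
  · simp

variable {ω : Ω → ℂ} {hω : IsHolo Ω ω} {ψ : Ω → Ω} {hψ : IsHolo Ω (fun z => (ψ z : ℂ))}

theorem IsSupercyclic.weight_ne_zero (hT : IsSupercyclic (weightedComp ω hω ψ hψ)) {z z' : Ω}
    (hz : z ≠ z') : ω z ≠ 0 := by
  intro h
  obtain ⟨g, hg, -⟩ := exists_apply_eq_and_apply_eq hz 1 0
  have := hT.eq_zero_of_comp_eq_zero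
    (φ := HoloSpace.evalCLM z) (fun f => ?_) (exists_apply_eq_and_apply_eq hz) g
  · rw [hg] at this
    exact one_ne_zero this
  · rw [HoloSpace.evalCLM_apply, weightedComp_apply, h, zero_mul]

theorem IsSupercyclic.symbol_injective (hT : IsSupercyclic (weightedComp ω hω ψ hψ)) :
    Function.Injective ψ := by
  intro z₁ z₂ h
  by_contra hz
  obtain ⟨g, hg₁, hg₂⟩ := exists_apply_eq_and_apply_eq hz 1 0
  have := hT.eq_zero_of_comp_eq_zero
    (φ := ω z₂ • HoloSpace.evalCLM z₁ + (-ω z₁) • HoloSpace.evalCLM z₂) (fun f => ?_)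
    (exists_apply_eq_and_apply_eq hz) g
  · change ω z₂ * HoloSpace.evalCLM z₁ g + -ω z₁ * HoloSpace.evalCLM z₂ g = 0 at this
    rw [hg₁, hg₂, mul_one, mul_zero, add_zero] at this
    exact hT.weight_ne_zero (Ne.symm hz) this
  · change ω z₂ * (ω z₁ * f (ψ z₁)) + -ω z₁ * (ω z₂ * f (ψ z₂)) = 0
    rw [h]
    ring

/-- The evaluations at two fixed points of the symbol are eigenfunctionals. -/
theorem IsSupercyclic.eq_of_fixed (hT : IsSupercyclic (weightedComp ω hω ψ hψ)) {z₁ z₂ : Ω}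
    (h₁ : ψ z₁ = z₁) (h₂ : ψ z₂ = z₂) : z₁ = z₂ := by
  by_contra hz
  obtain ⟨s, t, hst⟩ := hT.not_surjective_eigenfunctionals
    (φ := HoloSpace.evalCLM z₁) (χ := HoloSpace.evalCLM z₂) (μ := ω z₁) (ν := ω z₂)
    (fun f => by simp only [HoloSpace.evalCLM_apply, weightedComp_apply, h₁])
    (fun f => by simp only [HoloSpace.evalCLM_apply, weightedComp_apply, h₂])
  obtain ⟨f, hf⟩ := exists_apply_eq_and_apply_eq hz s t
  exact hst f hf

theorem IsSupercyclic.exists_norm_smul_iterate_sub_lt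
    {T : HoloSpace Ω →L[ℂ] HoloSpace Ω} (hT : IsSupercyclic T) :
    ∃ f : HoloSpace Ω, ∀ (g : HoloSpace Ω) (K : Set Ω), IsCompact K → ∀ ε > 0,
      ∃ (c : ℂ) (n : ℕ), ∀ z ∈ K, ‖(c • T^[n] f) z - g z‖ < ε := by
  obtain ⟨f, hf⟩ := hT
  refine ⟨f, fun g K hK ε hε => ?_⟩
  obtain ⟨_, ⟨c, n, rfl⟩, h⟩ := HoloSpace.exists_mem_dense_norm_sub_lt hf g hK hε
  exact ⟨c, n, h⟩

theorem isCompact_circle (r : ℝ) (hr : 0 < r) :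
    IsCompact {z : puncturedPlane | ‖(z : ℂ)‖ = r} := by
  rw [Subtype.isCompact_iff]
  convert isCompact_sphere (0 : ℂ) r
  ext z
  simp only [Set.mem_image, Set.mem_ofPred_eq, mem_sphere_iff_norm, sub_zero]
  constructor
  · rintro ⟨w, hw, rfl⟩
    exact hw
  · intro hz
    exact ⟨⟨z, norm_pos_iff.1 (hz ▸ hr)⟩, hz, rfl⟩

end Obstructions

/-! ### Weighted rotations are not supercyclic -/

section Rotations

/-- The logarithm of the geometric mean of `|f|` over the circle of radius `r`. -/
noncomputable def logMean (r : ℝ) (f : puncturedPlane → ℂ) : ℝ :=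
  Real.circleAverage (fun z => Real.log ‖zeroExtend f z‖) 0 r

theorem circleIntegrable_log_norm {G : ℂ → ℂ} {r : ℝ} (hr : 0 ≤ r)
    (hG : ContinuousOn G (Metric.sphere 0 r)) (hG0 : ∀ z ∈ Metric.sphere (0 : ℂ) r, G z ≠ 0) :
    CircleIntegrable (fun z => Real.log ‖G z‖) 0 r :=
  (hG.norm.log fun z hz => norm_ne_zero_iff.2 (hG0 z hz)).circleIntegrable hr

theorem continuousOn_zeroExtend_sphere {f : puncturedPlane → ℂ} (hf : IsHolo puncturedPlane f)
    {r : ℝ} (hr : 0 < r) : ContinuousOn (zeroExtend f) (Metric.sphere 0 r) :=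
  continuousOn_sphere hf.differentiableOn_zeroExtend hr

theorem zeroExtend_ne_zero_of_mem_sphere {f : puncturedPlane → ℂ} {r : ℝ} (hr : 0 < r)
    (hf : ∀ z : puncturedPlane, ‖(z : ℂ)‖ = r → f z ≠ 0) :
    ∀ z ∈ Metric.sphere (0 : ℂ) r, zeroExtend f z ≠ 0 := by
  intro z hz
  rw [mem_sphere_iff_norm, sub_zero] at hz
  have hz0 : z ≠ 0 := norm_pos_iff.1 (hz ▸ hr)
  rw [zeroExtend_of_mem f (mem_puncturedPlane.2 hz0)]
  exact hf _ hz

theorem logMean_mem_Icc {f : puncturedPlane → ℂ} (hf : IsHolo puncturedPlane f) {r a b : ℝ}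
    (hr : 0 < r) (ha : 0 < a) (h : ∀ z : puncturedPlane, ‖(z : ℂ)‖ = r → a ≤ ‖f z‖ ∧ ‖f z‖ ≤ b) :
    logMean r f ∈ Set.Icc (Real.log a) (Real.log b) := by
  have hint := circleIntegrable_log_norm hr.le (continuousOn_zeroExtend_sphere hf hr)
    (zeroExtend_ne_zero_of_mem_sphere hr fun z hz =>
      norm_pos_iff.1 (ha.trans_le (h z hz).1))
  have hbound : ∀ z ∈ Metric.sphere (0 : ℂ) |r|, a ≤ ‖zeroExtend f z‖ ∧ ‖zeroExtend f z‖ ≤ b := by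
    intro z hz
    rw [abs_of_pos hr, mem_sphere_iff_norm, sub_zero] at hz
    have hz0 : z ≠ 0 := norm_pos_iff.1 (hz ▸ hr)
    rw [zeroExtend_of_mem f (mem_puncturedPlane.2 hz0)]
    exact h _ hz
  constructor
  · rw [← Real.circleAverage_const (Real.log a) 0 r]
    refine Real.circleAverage_mono (circleIntegrable_const _ _ _) hint fun z hz => ?_
    exact Real.log_le_log ha (hbound z hz).1
  · refine Real.circleAverage_mono_on_of_le_circle hint fun z hz => ?_
    exact Real.log_le_log (ha.trans_le (hbound z hz).1) (hbound z hz).2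

theorem logMean_smul {f : HoloSpace puncturedPlane} {r : ℝ} (hr : 0 < r)
    (hf : ∀ z : puncturedPlane, ‖(z : ℂ)‖ = r → f z ≠ 0) {c : ℂ} (hc : c ≠ 0) :
    logMean r (c • f : HoloSpace puncturedPlane) = Real.log ‖c‖ + logMean r f := by
  have hint := circleIntegrable_log_norm hr.le
    (continuousOn_zeroExtend_sphere (HoloSpace.isHolo f) hr)
    (zeroExtend_ne_zero_of_mem_sphere hr hf)
  rw [logMean, logMean, ← Real.circleAverage_const (Real.log ‖c‖) 0 r,
    ← Real.circleAverage_fun_add (circleIntegrable_const _ _ _) hint]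
  refine Real.circleAverage_congr_sphere fun z hz => ?_
  rw [abs_of_pos hr] at hz
  have hz' := zeroExtend_ne_zero_of_mem_sphere hr hf z hz
  rw [mem_sphere_iff_norm, sub_zero] at hz
  have hz0 : z ∈ puncturedPlane := norm_pos_iff.1 (hz ▸ hr)
  rw [zeroExtend_of_mem _ hz0] at hz'
  change Real.log _ = Real.log _ + Real.log _
  rw [zeroExtend_of_mem _ hz0, zeroExtend_of_mem _ hz0, HoloSpace.smul_apply, norm_mul,
    Real.log_mul (norm_ne_zero_iff.2 hc) (norm_ne_zero_iff.2 hz')]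

variable {ω : puncturedPlane → ℂ} {hω : IsHolo puncturedPlane ω}
  {ψ : puncturedPlane → puncturedPlane} {hψ : IsHolo puncturedPlane (fun z => (ψ z : ℂ))} {b : ℂ}

theorem zeroExtend_weightedComp (hb : b ≠ 0) (hψb : ∀ z : puncturedPlane, (ψ z : ℂ) = b * z)
    (f : HoloSpace puncturedPlane) {z : ℂ} (hz : z ≠ 0) :
    zeroExtend (weightedComp ω hω ψ hψ f) z = zeroExtend ω z * zeroExtend f (b * z) := by
  rw [zeroExtend_of_mem _ (mem_puncturedPlane.2 hz), zeroExtend_of_mem _ (mem_puncturedPlane.2 hz),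
    zeroExtend_of_mem _ (mem_puncturedPlane.2 (mul_ne_zero hb hz)), weightedComp_apply]
  congr 2
  exact Subtype.ext (hψb _)

theorem ne_zero_of_iterate_ne_zero (hb : ‖b‖ = 1)
    (hψb : ∀ z : puncturedPlane, (ψ z : ℂ) = b * z) (n : ℕ) {f : HoloSpace puncturedPlane} {r : ℝ}
    (h : ∀ z : puncturedPlane, ‖(z : ℂ)‖ = r → ((weightedComp ω hω ψ hψ)^[n] f) z ≠ 0) :
    ∀ z : puncturedPlane, ‖(z : ℂ)‖ = r → f z ≠ 0 := by
  induction n with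
  | zero => exact h
  | succ n ih =>
    refine ih fun z hz hz0 => ?_
    have hb0 : b ≠ 0 := norm_pos_iff.1 (hb ▸ one_pos)
    let w : puncturedPlane := ⟨b⁻¹ * z, mul_ne_zero (inv_ne_zero hb0) (puncturedPlane_ne_zero z)⟩
    have hw : ψ w = z := Subtype.ext (by rw [hψb]; exact mul_inv_cancel_left₀ hb0 _)
    refine h w (by simp [w, hb, hz]) ?_
    rw [Function.iterate_succ_apply', weightedComp_apply, hw, hz0, mul_zero]

theorem logMean_weightedComp (hω0 : ∀ z, ω z ≠ 0) (hb : ‖b‖ = 1)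
    (hψb : ∀ z : puncturedPlane, (ψ z : ℂ) = b * z) {f : HoloSpace puncturedPlane} {r : ℝ}
    (hr : 0 < r) (hf : ∀ z : puncturedPlane, ‖(z : ℂ)‖ = r → f z ≠ 0) :
    logMean r (weightedComp ω hω ψ hψ f) = logMean r ω + logMean r f := by
  have hb0 : b ≠ 0 := norm_pos_iff.1 (hb ▸ one_pos)
  have hmaps : Set.MapsTo (fun z => b * z) (Metric.sphere (0 : ℂ) r) (Metric.sphere 0 r) :=
    fun z hz => by simpa [hb] using hz
  have h0 := zeroExtend_ne_zero_of_mem_sphere hr hf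
  have hcont := continuousOn_zeroExtend_sphere (HoloSpace.isHolo f) hr
  have hint₁ := circleIntegrable_log_norm hr.le (continuousOn_zeroExtend_sphere hω hr)
    (zeroExtend_ne_zero_of_mem_sphere hr fun z _ => hω0 z)
  have hint₂ : CircleIntegrable (fun z => Real.log ‖zeroExtend f (b * z)‖) 0 r :=
    circleIntegrable_log_norm hr.le
      (hcont.comp (continuous_const.mul continuous_id).continuousOn hmaps)
      fun z hz => h0 _ (hmaps hz)
  have hrot : logMean r f = Real.circleAverage (fun z => Real.log ‖zeroExtend f (b * z)‖) 0 r := by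
    have := circleAverage_comp_mul (fun z => Real.log ‖zeroExtend f z‖) b r
    rw [hb, one_mul] at this
    exact this.symm
  rw [hrot, logMean, logMean, ← Real.circleAverage_fun_add hint₁ hint₂]
  refine Real.circleAverage_congr_sphere fun z hz => ?_
  rw [abs_of_pos hr] at hz
  have hz0 : z ≠ 0 := by
    rintro rfl
    simp [hr.ne] at hz
  have h₁ := zeroExtend_ne_zero_of_mem_sphere hr (fun z _ => hω0 z) z hz
  change Real.log _ = Real.log _ + Real.log _
  rw [zeroExtend_weightedComp hb0 hψb f hz0, norm_mul,
    Real.log_mul (norm_ne_zero_iff.2 h₁) (norm_ne_zero_iff.2 (h0 _ (hmaps hz)))]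

theorem logMean_iterate_weightedComp (hω0 : ∀ z, ω z ≠ 0) (hb : ‖b‖ = 1)
    (hψb : ∀ z : puncturedPlane, (ψ z : ℂ) = b * z) (n : ℕ) {f : HoloSpace puncturedPlane} {r : ℝ}
    (hr : 0 < r)
    (h : ∀ z : puncturedPlane, ‖(z : ℂ)‖ = r → ((weightedComp ω hω ψ hψ)^[n] f) z ≠ 0) :
    logMean r ((weightedComp ω hω ψ hψ)^[n] f) = n * logMean r ω + logMean r f := by
  induction n generalizing f with
  | zero => simp
  | succ n ih =>
    rw [Function.iterate_succ_apply] at h ⊢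
    have hf := ne_zero_of_iterate_ne_zero hb hψb (n + 1) (f := f) (ω := ω) (hω := hω) (hψ := hψ)
      (r := r) h
    rw [ih h, logMean_weightedComp hω0 hb hψb hr hf]
    push_cast
    ring

/-- The quotient of the geometric means over the circles of radius `2` and `1` is multiplied by a
constant when a weighted rotation is applied, hence is bounded or bounded away from `0` along a
projective orbit, while it takes all the values `2 ^ k` on `H(ℂ*)`. -/
theorem not_isSupercyclic_of_norm_eq_one (hω0 : ∀ z, ω z ≠ 0) (hb : ‖b‖ = 1)
    (hψb : ∀ z : puncturedPlane, (ψ z : ℂ) = b * z) :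
    ¬ IsSupercyclic (weightedComp ω hω ψ hψ) := by
  intro hT
  obtain ⟨f, hf⟩ := hT.exists_norm_smul_iterate_sub_lt
  set T := weightedComp ω hω ψ hψ
  set δ := logMean 2 ω - logMean 1 ω with hδ
  set D := logMean 2 f - logMean 1 f with hD
  have key (k : ℤ) : ∃ n : ℕ, (k - 2) * Real.log 2 ≤ n * δ + D ∧
      n * δ + D ≤ (k + 2) * Real.log 2 := by
    obtain ⟨ε, hε, hε₁, hε₂⟩ : ∃ ε : ℝ, 0 < ε ∧ ε ≤ 1 / 2 ∧ ε ≤ (2 : ℝ) ^ k / 2 :=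
      ⟨min (1 / 2) ((2 : ℝ) ^ k / 2), by positivity, min_le_left _ _, min_le_right _ _⟩
    obtain ⟨c, n, hcn⟩ := hf (laurentMonomial k) _
      ((isCompact_circle 1 one_pos).union (isCompact_circle 2 two_pos)) ε hε
    have hmean (r : ℝ) (hr : r = 1 ∨ r = 2) :
        logMean r (c • T^[n] f : HoloSpace puncturedPlane) ∈
          Set.Icc (k * Real.log r - Real.log 2) (k * Real.log r + Real.log 2) ∧
        ∀ z : puncturedPlane, ‖(z : ℂ)‖ = r → (c • T^[n] f) z ≠ 0 := by
      have hr0 : 0 < r := by rcases hr with rfl | rfl <;> norm_num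
      have hrk : 0 < r ^ k := zpow_pos hr0 k
      have hεr : ε ≤ r ^ k / 2 := by
        rcases hr with rfl | rfl
        · simpa using hε₁
        · exact hε₂
      have hbound : ∀ z : puncturedPlane, ‖(z : ℂ)‖ = r →
          r ^ k / 2 ≤ ‖(c • T^[n] f) z‖ ∧ ‖(c • T^[n] f) z‖ ≤ 2 * r ^ k := by
        intro z hz
        have h₁ := hcn z (by rcases hr with rfl | rfl <;> simp [hz])
        rw [laurentMonomial_apply] at h₁
        have h₂ := norm_sub_norm_le ((z : ℂ) ^ k) ((c • T^[n] f) z)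
        have h₃ := norm_sub_norm_le ((c • T^[n] f) z) ((z : ℂ) ^ k)
        rw [norm_sub_rev, norm_zpow, hz] at h₂
        rw [norm_zpow, hz] at h₃
        constructor <;> linarith
      refine ⟨?_, fun z hz h => ?_⟩
      · have := logMean_mem_Icc (HoloSpace.isHolo (c • T^[n] f)) hr0 (half_pos hrk) hbound
        rwa [Real.log_div hrk.ne' two_ne_zero, Real.log_mul two_ne_zero hrk.ne', Real.log_zpow,
          add_comm (Real.log 2)] at this
      · have := (hbound z hz).1
        rw [h, norm_zero] at this
        linarith
    have hvalue (r : ℝ) (hr : r = 1 ∨ r = 2) :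
        logMean r (c • T^[n] f : HoloSpace puncturedPlane) =
          Real.log ‖c‖ + (n * logMean r ω + logMean r f) := by
      have hr0 : 0 < r := by rcases hr with rfl | rfl <;> norm_num
      have hne := (hmean r hr).2
      have hc : c ≠ 0 := by
        rintro rfl
        refine hne ⟨(r : ℂ), mem_puncturedPlane.2 (by exact_mod_cast hr0.ne')⟩ ?_ ?_
        · simp [hr0.le]
        · rw [HoloSpace.smul_apply, zero_mul]
      have hne' : ∀ z : puncturedPlane, ‖(z : ℂ)‖ = r → (T^[n] f) z ≠ 0 := fun z hz h =>
        hne z hz (by rw [HoloSpace.smul_apply, h, mul_zero])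
      rw [logMean_smul hr0 hne' hc, logMean_iterate_weightedComp hω0 hb hψb n hr0 hne']
    have h₁ := (hmean 1 (Or.inl rfl)).1
    have h₂ := (hmean 2 (Or.inr rfl)).1
    rw [hvalue 1 (Or.inl rfl), Real.log_one, mul_zero, zero_sub, zero_add, Set.mem_Icc] at h₁
    rw [hvalue 2 (Or.inr rfl), Set.mem_Icc] at h₂
    refine ⟨n, ?_, ?_⟩
    · rw [hδ, hD]
      linarith
    · rw [hδ, hD]
      linarith
  have hlog : 0 < Real.log 2 := Real.log_pos one_lt_two
  rcases le_total 0 δ with h | h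
  · obtain ⟨k, hk⟩ := exists_int_lt (D / Real.log 2 - 2)
    obtain ⟨n, -, hn⟩ := key k
    have h₁ : D ≤ (k + 2) * Real.log 2 := by
      have : 0 ≤ n * δ := by positivity
      linarith
    rw [← div_le_iff₀ hlog] at h₁
    linarith
  · obtain ⟨k, hk⟩ := exists_int_gt (D / Real.log 2 + 2)
    obtain ⟨n, hn, -⟩ := key k
    have h₁ : (k - 2) * Real.log 2 ≤ D := by
      have : n * δ ≤ 0 := mul_nonpos_of_nonneg_of_nonpos (by positivity) h
      linarith
    rw [← le_div_iff₀ hlog] at h₁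
    linarith

end Rotations

/-! ### Weighted dilations with the wrong order are not supercyclic -/

section Dilations

theorem laurentCoeff_zpow_mul_comp_mul {G : ℂ → ℂ} (hG : DifferentiableOn ℂ G {0}ᶜ) {b : ℂ}
    (hb : b ≠ 0) (c : ℂ) (m k : ℤ) :
    laurentCoeff (fun z => z ^ m * (c * G (b * z))) k =
      c * b ^ (k - m) * laurentCoeff G (k - m) := by
  have h₁ : laurentCoeff (fun z => z ^ m * (c * G (b * z))) k =
      Real.circleAverage (fun z => (c * b ^ (k - m)) • ((b * z) ^ (-(k - m)) * G (b * z))) 0 1 := by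
    refine Real.circleAverage_congr_sphere fun z hz => ?_
    have hz0 : z ≠ 0 := by
      rintro rfl
      simp at hz
    have h₂ : z ^ (-k) * z ^ m = z ^ (-(k - m)) := by
      rw [← zpow_add₀ hz0]
      congr 1
      ring
    have h₃ : b ^ (k - m) * b ^ (-(k - m)) = 1 := by
      rw [← zpow_add₀ hb]
      simp
    simp only [smul_eq_mul]
    rw [mul_zpow, ← h₂]
    linear_combination (-(z ^ (-k) * z ^ m * c * G (b * z))) * h₃
  rw [h₁, Real.circleAverage_fun_smul,
    circleAverage_comp_mul (fun w => w ^ (-(k - m)) * G w) b 1, mul_one,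
    ← laurentCoeff_eq_circleAverage hG _ (norm_pos_iff.2 hb), smul_eq_mul]

theorem laurentCoeff_smul (G : ℂ → ℂ) (c : ℂ) (k : ℤ) :
    laurentCoeff (fun z => c * G z) k = c * laurentCoeff G k := by
  rw [laurentCoeff, laurentCoeff, ← smul_eq_mul (a := c), ← Real.circleAverage_fun_smul]
  congr 1
  funext z
  simp only [smul_eq_mul]
  ring

theorem laurentCoeff_sub {F G : ℂ → ℂ} (hF : DifferentiableOn ℂ F {0}ᶜ)
    (hG : DifferentiableOn ℂ G {0}ᶜ) (k : ℤ) :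
    laurentCoeff (fun z => F z - G z) k = laurentCoeff F k - laurentCoeff G k := by
  have hint {H : ℂ → ℂ} (hH : DifferentiableOn ℂ H {0}ᶜ) :
      CircleIntegrable (fun z => z ^ (-k) * H z) 0 1 :=
    (continuousOn_sphere (differentiableOn_zpow_mul hH (-k)) one_pos).circleIntegrable zero_le_one
  rw [laurentCoeff, laurentCoeff, laurentCoeff, ← Real.circleAverage_fun_sub (hint hF) (hint hG)]
  congr 1
  funext z
  ring

theorem laurentCoeff_zpow (i k : ℤ) :
    laurentCoeff (fun z => z ^ i) k = if k = i then 1 else 0 := by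
  split_ifs with h
  · subst h
    rw [laurentCoeff, ← Real.circleAverage_const (1 : ℂ) 0 1]
    refine Real.circleAverage_congr_sphere fun z hz => ?_
    have hz0 : z ≠ 0 := by
      rintro rfl
      simp at hz
    rw [← zpow_add₀ hz0]
    simp
  · rw [laurentCoeff, Real.circleAverage_eq_circleIntegral one_ne_zero]
    have h₁ : (∮ z in C(0, 1), (z - 0)⁻¹ • (z ^ (-k) * z ^ i)) =
        ∮ z in C(0, 1), (z - 0) ^ (-1 - k + i) := by
      refine circleIntegral.integral_congr zero_le_one fun z hz => ?_
      have hz0 : z ≠ 0 := by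
        rintro rfl
        simp at hz
      simp only [sub_zero, smul_eq_mul]
      rw [zpow_add₀ hz0, zpow_sub₀ hz0, zpow_neg, zpow_neg_one, div_eq_mul_inv]
      ring
    rw [h₁, circleIntegral.integral_sub_zpow_of_ne (by omega), smul_zero]

variable {E : ℂ → ℂ} {c b : ℂ} {m : ℤ}

/-- The Laurent coefficients of `f / E`. -/
noncomputable def weightedCoeff (E : ℂ → ℂ) (f : HoloSpace puncturedPlane) (k : ℤ) : ℂ :=
  laurentCoeff (fun z => zeroExtend f z / E z) k

theorem differentiableOn_zeroExtend_div (hE : DifferentiableOn ℂ E {0}ᶜ) (hE0 : ∀ z, E z ≠ 0)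
    (f : HoloSpace puncturedPlane) : DifferentiableOn ℂ (fun z => zeroExtend f z / E z) {0}ᶜ :=
  (HoloSpace.differentiableOn_zeroExtend f).div hE fun z _ => hE0 z

theorem laurentCoeff_congr {F G : ℂ → ℂ} (h : ∀ z, z ≠ 0 → F z = G z) (k : ℤ) :
    laurentCoeff F k = laurentCoeff G k := by
  refine Real.circleAverage_congr_sphere fun z hz => ?_
  have hz0 : z ≠ 0 := by
    rintro rfl
    simp at hz
  simp only [h z hz0]

theorem weightedCoeff_smul (f : HoloSpace puncturedPlane) (a : ℂ) (k : ℤ) :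
    weightedCoeff E (a • f) k = a * weightedCoeff E f k := by
  rw [weightedCoeff, weightedCoeff, ← laurentCoeff_smul]
  refine laurentCoeff_congr (fun z hz => ?_) k
  rw [zeroExtend_of_mem _ (mem_puncturedPlane.2 hz), zeroExtend_of_mem _ (mem_puncturedPlane.2 hz),
    HoloSpace.smul_apply, mul_div_assoc]

theorem weightedCoeff_weightedMonomial (hE : DifferentiableOn ℂ E {0}ᶜ) (hE0 : ∀ z, E z ≠ 0)
    (i k : ℤ) : weightedCoeff E (weightedMonomial E hE i) k = if k = i then 1 else 0 := by
  rw [weightedCoeff, ← laurentCoeff_zpow]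
  refine laurentCoeff_congr (fun z hz => ?_) k
  rw [zeroExtend_of_mem _ (mem_puncturedPlane.2 hz), weightedMonomial_apply,
    mul_div_cancel_right₀ _ (hE0 z)]

theorem exists_norm_weightedCoeff_sub_le (hE : DifferentiableOn ℂ E {0}ᶜ) (hE0 : ∀ z, E z ≠ 0) :
    ∃ M > 0, ∀ (f g : HoloSpace puncturedPlane) (ε : ℝ),
      (∀ z : puncturedPlane, ‖(z : ℂ)‖ = 1 → ‖f z - g z‖ ≤ ε) →
      ∀ k, ‖weightedCoeff E f k - weightedCoeff E g k‖ ≤ M * ε := by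
  obtain ⟨M, hM⟩ := (isCompact_sphere (0 : ℂ) 1).exists_bound_of_continuousOn
    ((continuousOn_sphere hE one_pos).inv₀ fun z _ => hE0 z)
  refine ⟨max M 1, by positivity, fun f g ε h k => ?_⟩
  rw [weightedCoeff, weightedCoeff, ← laurentCoeff_sub (differentiableOn_zeroExtend_div hE hE0 f)
    (differentiableOn_zeroExtend_div hE hE0 g)]
  have hdiff := (differentiableOn_zeroExtend_div hE hE0 f).sub
    (differentiableOn_zeroExtend_div hE hE0 g)
  have := norm_laurentCoeff_le hdiff one_pos (C := max M 1 * ε) (fun z hz => ?_) k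
  · rwa [one_zpow, mul_one] at this
  · have hz1 : ‖z‖ = 1 := by simpa using hz
    have hz0 : z ≠ 0 := norm_pos_iff.1 (hz1 ▸ one_pos)
    have h₁ := h ⟨z, hz0⟩ hz1
    have h₂ := hM z hz
    simp only [Pi.sub_apply, Pi.inv_apply] at h₂ ⊢
    rw [← sub_div, div_eq_mul_inv, norm_mul, mul_comm,
      zeroExtend_of_mem _ (mem_puncturedPlane.2 hz0),
      zeroExtend_of_mem _ (mem_puncturedPlane.2 hz0)]
    exact mul_le_mul (h₂.trans (le_max_left _ _)) h₁ (norm_nonneg _) (by positivity)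

variable {ω : puncturedPlane → ℂ} {hω : IsHolo puncturedPlane ω}
  {ψ : puncturedPlane → puncturedPlane} {hψ : IsHolo puncturedPlane (fun z => (ψ z : ℂ))}

theorem weightedCoeff_weightedComp (hE : DifferentiableOn ℂ E {0}ᶜ) (hE0 : ∀ z, E z ≠ 0)
    (hb : b ≠ 0) (hωE : ∀ z : puncturedPlane, ω z = (z : ℂ) ^ m * (c * (E z / E (b * z))))
    (hψb : ∀ z : puncturedPlane, (ψ z : ℂ) = b * z) (f : HoloSpace puncturedPlane) (k : ℤ) :
    weightedCoeff E (weightedComp ω hω ψ hψ f) k =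
      c * b ^ (k - m) * weightedCoeff E f (k - m) := by
  rw [weightedCoeff, weightedCoeff,
    ← laurentCoeff_zpow_mul_comp_mul (differentiableOn_zeroExtend_div hE hE0 f) hb]
  refine laurentCoeff_congr (fun z hz => ?_) k
  have h₁ := hE0 z
  have h₂ := hE0 (b * z)
  rw [zeroExtend_weightedComp hb hψb f hz, zeroExtend_of_mem _ (mem_puncturedPlane.2 hz), hωE]
  field_simp

theorem exists_norm_weightedCoeff_iterate (hE : DifferentiableOn ℂ E {0}ᶜ) (hE0 : ∀ z, E z ≠ 0)
    (hb : b ≠ 0) (hωE : ∀ z : puncturedPlane, ω z = (z : ℂ) ^ m * (c * (E z / E (b * z))))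
    (hψb : ∀ z : puncturedPlane, (ψ z : ℂ) = b * z) (n : ℕ) :
    ∃ A : ℝ, 0 ≤ A ∧ ∀ (f : HoloSpace puncturedPlane) (k : ℤ),
      ‖weightedCoeff E ((weightedComp ω hω ψ hψ)^[n] f) k‖ =
        A * (‖b‖ ^ k) ^ n * ‖weightedCoeff E f (k - n * m)‖ := by
  induction n with
  | zero => exact ⟨1, zero_le_one, fun f k => by simp⟩
  | succ n ih =>
    obtain ⟨A, hA, h⟩ := ih
    refine ⟨‖c‖ * ‖b‖ ^ (-m) * A * (‖b‖ ^ (-m)) ^ n, by positivity, fun f k => ?_⟩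
    have hb' : ‖b‖ ≠ 0 := norm_ne_zero_iff.2 hb
    rw [Function.iterate_succ_apply', weightedCoeff_weightedComp hE hE0 hb hωE hψb, norm_mul,
      norm_mul, norm_zpow, h, sub_eq_add_neg k m, zpow_add₀ hb', mul_pow, pow_succ]
    have hk : k + -m - n * m = k - ((n + 1 : ℕ) : ℤ) * m := by
      push_cast
      ring
    rw [hk]
    ring

/-- Let `ω(z) = c z ^ m E(z) / E(bz)` and `ψ(z) = bz`, where `|b| < 1` and `m ≤ 0`, or `|b| > 1` and
`m ≥ 0`. Then the operator is not supercyclic. Let `d_k` be the Laurent coefficients of `f / E`. The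
coefficient of `T ^ n f / E` that comes from `d_j` sits at position `j + n m`. Compare it with the one
in a fixed position `i`, next to `j` on the side where `|b| ^ k` is smaller: it is at least as large,
up to a factor independent of `n`, so that no multiple of `T ^ n f / E` is close to `z ^ i`. -/
theorem not_isSupercyclic_of_order (hE : DifferentiableOn ℂ E {0}ᶜ) (hE0 : ∀ z, E z ≠ 0)
    (hb : b ≠ 0) (hbm : (‖b‖ < 1 ∧ m ≤ 0) ∨ (1 < ‖b‖ ∧ 0 ≤ m))
    (hωE : ∀ z : puncturedPlane, ω z = (z : ℂ) ^ m * (c * (E z / E (b * z))))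
    (hψb : ∀ z : puncturedPlane, (ψ z : ℂ) = b * z) :
    ¬ IsSupercyclic (weightedComp ω hω ψ hψ) := by
  intro hT
  obtain ⟨f, hf⟩ := hT.exists_norm_smul_iterate_sub_lt
  set T := weightedComp ω hω ψ hψ
  obtain ⟨M, hM, hMd⟩ := exists_norm_weightedCoeff_sub_le hE hE0
  have hb' : 0 < ‖b‖ := norm_pos_iff.2 hb
  have happrox (i : ℤ) (ε : ℝ) (hε : 0 < ε) : ∃ (a : ℂ) (n : ℕ), ∀ k,
      ‖weightedCoeff E (a • T^[n] f) k - if k = i then 1 else 0‖ ≤ ε := by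
    obtain ⟨a, n, h⟩ := hf (weightedMonomial E hE i) _ (isCompact_circle 1 one_pos) (ε / M)
      (by positivity)
    refine ⟨a, n, fun k => ?_⟩
    have := hMd _ _ _ (fun z hz => (h z hz).le) k
    rwa [weightedCoeff_weightedMonomial hE hE0, mul_div_cancel₀ _ hM.ne'] at this
  have hiter (n : ℕ) := exists_norm_weightedCoeff_iterate (hω := hω) (hψ := hψ) hE hE0 hb hωE hψb n
  obtain ⟨j, hj⟩ : ∃ j, 0 < ‖weightedCoeff E f j‖ := by
    obtain ⟨a, n, h⟩ := happrox 0 (1 / 2) (by norm_num)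
    obtain ⟨A, -, hA⟩ := hiter n
    refine ⟨0 - n * m, norm_pos_iff.2 fun h0 => ?_⟩
    have h₁ : weightedCoeff E (T^[n] f) 0 = 0 := by
      rw [← norm_eq_zero, hA, h0, norm_zero, mul_zero]
    have h₂ := h 0
    rw [weightedCoeff_smul, h₁, if_pos rfl, mul_zero, zero_sub, norm_neg, norm_one] at h₂
    norm_num at h₂
  obtain ⟨C, hC⟩ : ∃ C : ℝ, ∀ k, ‖weightedCoeff E f k‖ ≤ C := by
    obtain ⟨C, hC⟩ := exists_norm_laurentCoeff_le
      (differentiableOn_zeroExtend_div hE hE0 f) one_pos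
    refine ⟨C, fun k => ?_⟩
    have := hC k
    rwa [one_zpow, mul_one] at this
  have hCpos : 0 < C := hj.trans_le (hC j)
  -- The position next to `j` in the direction in which `‖b‖ ^ k` decreases.
  obtain ⟨i, hi, hij⟩ : ∃ i : ℤ, (∀ n : ℕ, ‖b‖ ^ i ≤ ‖b‖ ^ (j + n * m)) ∧
      ∀ n : ℕ, j + n * m ≠ i := by
    rcases hbm with ⟨hb1, hm⟩ | ⟨hb1, hm⟩
    · refine ⟨j + 1, fun n => ?_, fun n h => ?_⟩
      · exact zpow_le_zpow_right_of_le_one₀ hb' hb1.le (by nlinarith [Int.natCast_nonneg n])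
      · nlinarith [Int.natCast_nonneg n]
    · refine ⟨j - 1, fun n => ?_, fun n h => ?_⟩
      · exact zpow_le_zpow_right₀ hb1.le (by nlinarith [Int.natCast_nonneg n])
      · nlinarith [Int.natCast_nonneg n]
  set d := ‖weightedCoeff E f j‖
  obtain ⟨a, n, h⟩ := happrox i (d / (2 * (C + d))) (by positivity)
  obtain ⟨A, hA, hAn⟩ := hiter n
  have h₁ := h i
  have h₂ := h (j + n * m)
  rw [if_pos rfl] at h₁
  rw [if_neg (hij n), sub_zero] at h₂
  have h₃ : ‖weightedCoeff E (a • T^[n] f) i‖ * d ≤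
      ‖weightedCoeff E (a • T^[n] f) (j + n * m)‖ * C := by
    rw [weightedCoeff_smul, weightedCoeff_smul, norm_mul, norm_mul, hAn, hAn,
      add_sub_cancel_right]
    calc ‖a‖ * (A * (‖b‖ ^ i) ^ n * ‖weightedCoeff E f (i - n * m)‖) * d
        ≤ ‖a‖ * (A * (‖b‖ ^ (j + n * m)) ^ n * C) * d := by
          have hp := pow_le_pow_left₀ (by positivity) (hi n) n
          exact mul_le_mul_of_nonneg_right (mul_le_mul_of_nonneg_left
            (mul_le_mul (mul_le_mul_of_nonneg_left hp hA) (hC _) (norm_nonneg _) (by positivity))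
            (norm_nonneg _)) (norm_nonneg _)
      _ = ‖a‖ * (A * (‖b‖ ^ (j + n * m)) ^ n * d) * C := by ring
  have h₄ : 1 - d / (2 * (C + d)) ≤ ‖weightedCoeff E (a • T^[n] f) i‖ := by
    have := norm_sub_norm_le (1 : ℂ) (weightedCoeff E (a • T^[n] f) i)
    rw [norm_one, norm_sub_rev] at this
    linarith
  have h₅ : (1 - d / (2 * (C + d))) * d ≤ d / (2 * (C + d)) * C := by
    calc (1 - d / (2 * (C + d))) * d ≤ ‖weightedCoeff E (a • T^[n] f) i‖ * d := by gcongr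
      _ ≤ _ := h₃
      _ ≤ d / (2 * (C + d)) * C := by gcongr
  have h₆ : d / (2 * (C + d)) * (C + d) = d / 2 := by
    field_simp
  linarith

end Dilations

/-! ### The characterization -/

section Characterization

variable {ω : puncturedPlane → ℂ} {hω : IsHolo puncturedPlane ω}
  {ψ : puncturedPlane → puncturedPlane} {hψ : IsHolo puncturedPlane (fun z => (ψ z : ℂ))}

theorem IsSupercyclic.ne_zero_puncturedPlane (hT : IsSupercyclic (weightedComp ω hω ψ hψ))
    (z : puncturedPlane) : ω z ≠ 0 := by
  refine hT.weight_ne_zero (z' := ⟨2 * z, mul_ne_zero two_ne_zero (puncturedPlane_ne_zero z)⟩)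
    fun h => ?_
  have h₁ : (z : ℂ) = 2 * z := congrArg Subtype.val h
  exact puncturedPlane_ne_zero z (by linear_combination -h₁)

/-- The symbol of a supercyclic operator is a dilation: an inversion `z ↦ b/z` has the two fixed
points `±√b`. -/
theorem IsSupercyclic.exists_symbol_eq_mul (hT : IsSupercyclic (weightedComp ω hω ψ hψ)) :
    ∃ b : ℂ, b ≠ 0 ∧ ∀ z : puncturedPlane, (ψ z : ℂ) = b * z := by
  have hF := IsHolo.differentiableOn_zeroExtend hψ
  have hFz (z : ℂ) (hz : z ≠ 0) : zeroExtend (fun z => (ψ z : ℂ)) z = ψ ⟨z, hz⟩ :=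
    zeroExtend_of_mem _ (mem_puncturedPlane.2 hz)
  obtain ⟨b, hb, h | h⟩ := eq_mul_or_eq_div_of_injOn hF
    (fun z hz => by rw [hFz z hz]; exact puncturedPlane_ne_zero _)
    (fun z hz w hw hzw => by
      rw [hFz z hz, hFz w hw] at hzw
      exact congrArg Subtype.val (hT.symbol_injective (Subtype.ext hzw)))
  · refine ⟨b, hb, fun z => ?_⟩
    rw [← h z (puncturedPlane_ne_zero z)]
    exact (zeroExtend_apply (fun z => (ψ z : ℂ)) z).symm
  · exfalso
    obtain ⟨β, hβ⟩ := IsAlgClosed.exists_pow_nat_eq b (n := 2) two_pos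
    have hβ0 : β ≠ 0 := by
      rintro rfl
      exact hb (by simpa using hβ.symm)
    have hfix (γ : ℂ) (hγ : γ ≠ 0) (hγb : γ ^ 2 = b) :
        ψ ⟨γ, mem_puncturedPlane.2 hγ⟩ = ⟨γ, mem_puncturedPlane.2 hγ⟩ := by
      apply Subtype.ext
      rw [← hFz γ hγ, h γ hγ, ← hγb]
      field_simp
    have := hT.eq_of_fixed (hfix β hβ0 hβ) (hfix (-β) (neg_ne_zero.2 hβ0) (by simpa using hβ))
    have h₁ : β = -β := congrArg Subtype.val this
    exact hβ0 (self_eq_neg.1 h₁)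

theorem IsSupercyclic.exists_order (hT : IsSupercyclic (weightedComp ω hω ψ hψ)) :
    ∃ (m : ℤ) (W : puncturedPlane → ℂ) (b : ℂ), IsHolo puncturedPlane W ∧ b ≠ 0 ∧
      ((‖b‖ < 1 ∧ 0 < m) ∨ (1 < ‖b‖ ∧ m < 0)) ∧
      ∀ z : puncturedPlane, ω z = (z : ℂ) ^ m * Complex.exp (W z) ∧ (ψ z : ℂ) = b * z := by
  obtain ⟨b, hb, hψb⟩ := hT.exists_symbol_eq_mul
  have hω0 := hT.ne_zero_puncturedPlane
  have hb1 : ‖b‖ ≠ 1 := fun h => not_isSupercyclic_of_norm_eq_one hω0 h hψb hT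
  obtain ⟨m, W, hW, hωW⟩ := exists_zpow_mul_exp_eq hω.differentiableOn_zeroExtend fun z hz => by
    rw [zeroExtend_of_mem _ (mem_puncturedPlane.2 hz)]
    exact hω0 _
  have hωW' (z : puncturedPlane) : ω z = (z : ℂ) ^ m * Complex.exp (W z) := by
    rw [← hωW z (puncturedPlane_ne_zero z), zeroExtend_apply]
  obtain ⟨c, E, -, hE, hE0, hWE⟩ := exists_exp_eq_mul_div_comp_mul hW hb hb1
  have hωE (z : puncturedPlane) : ω z = (z : ℂ) ^ m * (c * (E z / E (b * z))) := by
    rw [hωW', hWE z (puncturedPlane_ne_zero z)]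
  refine ⟨m, fun z => W z, b, ⟨W, hW, fun _ => rfl⟩, hb, ?_, fun z => ⟨hωW' z, hψb z⟩⟩
  have hnot (hbm : (‖b‖ < 1 ∧ m ≤ 0) ∨ (1 < ‖b‖ ∧ 0 ≤ m)) : False :=
    not_isSupercyclic_of_order hE hE0 hb hbm hωE hψb hT
  rcases lt_or_gt_of_ne hb1 with h | h
  · exact Or.inl ⟨h, not_le.1 fun hm => hnot (Or.inl ⟨h, hm⟩)⟩
  · exact Or.inr ⟨h, not_le.1 fun hm => hnot (Or.inr ⟨h, hm⟩)⟩

theorem satisfiesFHC_of_order {m : ℤ} {W : puncturedPlane → ℂ} {b : ℂ}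
    (hW : IsHolo puncturedPlane W) (hb : b ≠ 0) (hb1 : ‖b‖ ≠ 1) (hbm : ‖b‖ ^ m < 1)
    (h : ∀ z : puncturedPlane, ω z = (z : ℂ) ^ m * Complex.exp (W z) ∧ (ψ z : ℂ) = b * z) :
    SatisfiesFHC (weightedComp ω hω ψ hψ) := by
  obtain ⟨c, E, hc, hE, hE0, hWE⟩ :=
    exists_exp_eq_mul_div_comp_mul hW.differentiableOn_zeroExtend hb hb1
  refine satisfiesFHC_weightedComp hω hψ hE hE0 hc hb hbm (fun z => ?_) fun z => (h z).2
  rw [(h z).1, ← hWE z (puncturedPlane_ne_zero z), zeroExtend_apply]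

end Characterization

theorem theorem1p3 (ω : puncturedPlane → ℂ) (hω : IsHolo puncturedPlane ω)
    (ψ : puncturedPlane → puncturedPlane)
    (hψ : IsHolo puncturedPlane (fun z => (ψ z : ℂ))) :
    -- the three equivalent conditions
    List.TFAE [
      IsSupercyclic (weightedComp ω hω ψ hψ),
      SatisfiesFHC (weightedComp ω hω ψ hψ),
      ∃ (n : ℕ) (W : puncturedPlane → ℂ) (a : ℂ),
        1 ≤ n ∧ IsHolo puncturedPlane W ∧ 0 < ‖a‖ ∧ ‖a‖ < 1 ∧
        ((∀ z : puncturedPlane,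
            ω z = (z : ℂ) ^ n * Complex.exp (W z) ∧ (ψ z : ℂ) = a * z) ∨
         (∀ z : puncturedPlane,
            ω z = ((z : ℂ) ^ n)⁻¹ * Complex.exp (W z) ∧ (ψ z : ℂ) = 1 / a * z))] ∧
    -- the dynamical properties that the operator has in this case
    (SatisfiesFHC (weightedComp ω hω ψ hψ) →
      IsFrequentlyHypercyclic (weightedComp ω hω ψ hψ) ∧
      IsTopMixing (weightedComp ω hω ψ hψ) ∧
      IsChaotic (weightedComp ω hω ψ hψ)) ∧
    -- the two questions of the Goliński–Przestacki problem
    (IsHypercyclic (weightedComp ω hω ψ hψ) →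
      IsFrequentlyHypercyclic (weightedComp ω hω ψ hψ)) ∧
    ((∀ z : puncturedPlane, ω z = (z : ℂ) * Complex.exp (1 / (z : ℂ))) →
      (∀ z : puncturedPlane, (ψ z : ℂ) = (z : ℂ) / 2) →
      IsFrequentlyHypercyclic (weightedComp ω hω ψ hψ)) := by
  set T := weightedComp ω hω ψ hψ
  have hsuper : SatisfiesFHC T → IsSupercyclic T := fun h =>
    h.isFrequentlyHypercyclic_holoSpace.isHypercyclic.isSupercyclic
  have htfae : List.TFAE [IsSupercyclic T, SatisfiesFHC T,
      ∃ (n : ℕ) (W : puncturedPlane → ℂ) (a : ℂ),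
        1 ≤ n ∧ IsHolo puncturedPlane W ∧ 0 < ‖a‖ ∧ ‖a‖ < 1 ∧
        ((∀ z : puncturedPlane,
            ω z = (z : ℂ) ^ n * Complex.exp (W z) ∧ (ψ z : ℂ) = a * z) ∨
         (∀ z : puncturedPlane,
            ω z = ((z : ℂ) ^ n)⁻¹ * Complex.exp (W z) ∧ (ψ z : ℂ) = 1 / a * z))] := by
    tfae_have 2 → 1 := hsuper
    tfae_have 1 → 3 := by
      intro hT
      obtain ⟨m, W, b, hW, hb, hbm, h⟩ := hT.exists_order
      rcases hbm with ⟨hb1, hm⟩ | ⟨hb1, hm⟩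
      · obtain ⟨n, rfl⟩ := Int.eq_ofNat_of_zero_le hm.le
        refine ⟨n, W, b, by omega, hW, norm_pos_iff.2 hb, hb1, Or.inl fun z => ?_⟩
        simpa using h z
      · obtain ⟨n, hn⟩ := Int.eq_ofNat_of_zero_le (neg_nonneg.2 hm.le)
        obtain rfl : m = -n := by omega
        refine ⟨n, W, b⁻¹, by omega, hW, norm_pos_iff.2 (inv_ne_zero hb), ?_, Or.inr fun z => ?_⟩
        · rw [norm_inv]
          exact inv_lt_one_of_one_lt₀ hb1
        · simpa using h z
    tfae_have 3 → 2 := by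
      rintro ⟨n, W, a, hn, hW, ha0, ha1, h | h⟩
      · refine satisfiesFHC_of_order (m := n) hW (norm_pos_iff.1 ha0) ha1.ne ?_ fun z => ?_
        · rw [zpow_natCast]
          exact pow_lt_one₀ ha0.le ha1 (by omega)
        · simpa using h z
      · refine satisfiesFHC_of_order (m := -n) (b := 1 / a) hW
          (one_div_ne_zero (norm_pos_iff.1 ha0)) ?_ ?_ fun z => ?_
        · rw [norm_div, norm_one, one_div]
          exact (one_lt_inv₀ ha0 |>.2 ha1).ne'
        · rw [norm_div, norm_one, one_div, inv_zpow, zpow_neg, inv_inv, zpow_natCast]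
          exact pow_lt_one₀ ha0.le ha1 (by omega)
        · rw [zpow_neg, zpow_natCast]
          exact h z
    tfae_finish
  have h12 : IsSupercyclic T → SatisfiesFHC T := (htfae.out 0 1).1
  refine ⟨htfae, fun h => ⟨h.isFrequentlyHypercyclic_holoSpace, h.isTopMixing_holoSpace,
    h.isChaotic_holoSpace⟩, fun h => (h12 h.isSupercyclic).isFrequentlyHypercyclic_holoSpace,
    fun hω₁ hψ₁ => ?_⟩
  have hW : IsHolo puncturedPlane fun z => 1 / (z : ℂ) :=
    ⟨fun z => 1 / z, (differentiableOn_const 1).div differentiableOn_id fun z hz => hz,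
      fun _ => rfl⟩
  have hfhc : SatisfiesFHC T :=
    satisfiesFHC_of_order (m := 1) (b := 1 / 2) hW (by norm_num) (by norm_num) (by norm_num)
      fun z => ⟨by rw [zpow_one, hω₁], by rw [hψ₁]; ring⟩
  exact hfhc.isFrequentlyHypercyclic_holoSpace
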